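/- **Theorem.** Let $1\le N\le\infty$ and $E=\{i\in\mathbb Z_+: 0\le i<N+1\}$. Consider a birth–death chain on $E$ with birth rates $b_i>0$ $(0\le i<N)$, $b_N=0$ if $N<\infty$, and death rates $a_i>0$ $(1\le i<N+1)$, $a_0=0$. Put $\mu_0=1$, $\mu_n=\dfrac{b_0\cdots b_{n-1}}{a_1\cdots a_n}$ $(1\le n<N+1)$ and assume $Z:=\sum_{i\in E}\mu_i<\infty$. Let $\pi=\mu/Z$, write $\mu(f)=\sum_{i\in E}\mu_if_i$, and let $$\lambda_1=\inf\{D(f): f\in L^2(\mu),\ D(f)<\infty,\ \mu(f)=0,\ \mu(f^2)=1\},\qquad D(f)=\sum_{0\le i<N}\mu_ib_i(f_{i+1}-f_i)^2,$$ be the spectral gap of the maximal Dirichlet form. Suprema and infima below are taken in $[-\infty,\infty]$. (1) *Difference form.* For $0\le i<N$ let $$R_i(v)=a_{i+1}+b_i-\frac{a_i}{v_{i-1}}-b_{i+1}v_i ,$$ where the term $a_0/v_{-1}$ is $0$ and $a_i/0=\infty$ for $i\ge1$ (so $R_i(v)=-\infty$ if $i\ge 1$ and $v_{i-1}=0$).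 Let $\mathcal V=\{v: v_i>0 \text{ for all } 0\le i<N-1\}$. Then $$\lambda_1=\sup_{v\in\mathcal V}\ \inf_{0\le i<N}R_i(v).$$ For finite $m$ with $2\le m\le N$, let $\widetilde{\mathcal V}_m$ be the set of $v$ such that $$\frac{a_{i+1}}{a_{i+2}+b_{i+1}}<v_i<\frac{a_{i+1}+b_i-a_i/v_{i-1}}{b_{i+1}}\quad (0\le i\le m-2),\qquad v_i=0\quad (i\ge m-1),$$ let $\widetilde{\mathcal V}=\bigcup_{2\le m\le N,\,m<\infty}\widetilde{\mathcal V}_m$ (a disjoint union), and for $v\in\widetilde{\mathcal V}_m$ let $\widetilde R_i(v)$ be $R_i(v)$ with $a_m$ replaced by $\tilde a_m=\mu_ma_m/\sum_{k=m}^N\mu_k$. If $N\ge2$, then $$\inf_{v\in\widetilde{\mathcal V}}\ \sup_{0\le i<N}\widetilde R_i(v)=\lambda_1 .$$ (2) *Single summation form.* For $1\le i\in E$ let $$I_i(f)=\frac1{\mu_ia_i(f_i-f_{i-1})}\sum_{j=i}^N\mu_jf_j ,$$ with $I_i(f)^{-1}=0$ when $f_i=f_{i-1}$, and let $\bar f=f-\pi(f)$.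 Let - $\mathcal F_I$ be the set of $f\in L^1(\mu)$ with $f_0=0$, $f_i>0$ for $1\le i\in E$, and $f$ strictly increasing on $E$; - $\widetilde{\mathcal F}_I$ be the set of $f$ with $f_0=0$ for which there is $1\le m\in E$ such that $f_i=f_{i\wedge m}>0$ for $1\le i\in E$ and $f$ is strictly increasing on $\{1,\dots,m\}$; - $\widetilde{\mathcal F}_I'$ be the set of $f\in L^2(\mu)$ with $f_0=0$ and $f$ strictly increasing on $E$. Then $$\inf_{f\in\widetilde{\mathcal F}_I\cup\widetilde{\mathcal F}_I'}\ \sup_{1\le i\in E}I_i(\bar f)^{-1}=\lambda_1=\sup_{f\in\mathcal F_I}\ \inf_{1\le i\in E}I_i(\bar f)^{-1}.$$ -/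

import Mathlib

/-! Birth-death chains on `E = {i : 0 ≤ i < N + 1}`, with `N ≤ ∞` encoded as `N : ℕ∞`.
Functions on `E` are represented by sequences on `ℕ`; values outside `E` are never used.
The birth rates are `b i` for `0 ≤ i < N` and `b N = 0` when `N < ∞`; the death rates are `a i`
for `1 ≤ i ≤ N`.  There is no death at `0`, and the number `a 0` is never used. -/

namespace BirthDeath

/-- The state space `E = {i : 0 ≤ i < N + 1}`. -/
def E (N : ℕ∞) : Set ℕ := {i | (i : ℕ∞) ≤ N}

/-- The symmetric measure: `μ_0 = 1`, `μ_n = b_0 ⋯ b_{n-1} / (a_1 ⋯ a_n)`. -/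
noncomputable def mu (a b : ℕ → ℝ) (n : ℕ) : ℝ :=
  (∏ i ∈ Finset.range n, b i) / ∏ i ∈ Finset.range n, a (i + 1)

/-- `μ(f) = ∑_{i ∈ E} μ_i f_i`. -/
noncomputable def integral (N : ℕ∞) (a b f : ℕ → ℝ) : ℝ := ∑' i : E N, mu a b i * f i

/-- `f ∈ L¹(μ)`. -/
def MemL1 (N : ℕ∞) (a b f : ℕ → ℝ) : Prop := Summable fun i : E N => mu a b i * |f i|

/-- `f ∈ L²(μ)`. -/
def MemL2 (N : ℕ∞) (a b f : ℕ → ℝ) : Prop := Summable fun i : E N => mu a b i * f i ^ 2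

/-- `D(f) = ∑_{0 ≤ i < N} μ_i b_i (f_{i+1} - f_i)²`, used only on `maxDomain`. -/
noncomputable def dirichletForm (N : ℕ∞) (a b f : ℕ → ℝ) : ℝ :=
  ∑' i : {i : ℕ | (i : ℕ∞) < N}, mu a b i * b i * (f (i + 1) - f i) ^ 2

/-- The domain of the maximal Dirichlet form, `{f ∈ L²(μ) : D(f) < ∞}`. -/
def maxDomain (N : ℕ∞) (a b : ℕ → ℝ) : Set (ℕ → ℝ) :=
  {f | MemL2 N a b f ∧
    Summable fun i : {i : ℕ | (i : ℕ∞) < N} => mu a b i * b i * (f (i + 1) - f i) ^ 2}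

/-- The spectral gap `λ₁ = inf {D(f) : f ∈ 𝒟ᵐᵃˣ(D), μ(f) = 0, μ(f²) = 1}`. -/
noncomputable def spectralGap (N : ℕ∞) (a b : ℕ → ℝ) : ℝ :=
  sInf {x | ∃ f ∈ maxDomain N a b, integral N a b f = 0 ∧
    integral N a b (fun i => f i ^ 2) = 1 ∧ x = dirichletForm N a b f}

/-- `∑_{j=i}^N g_j`. -/
noncomputable def tailSum (N : ℕ∞) (g : ℕ → ℝ) (i : ℕ) : ℝ :=
  ∑' j : {j : ℕ | i ≤ j ∧ (j : ℕ∞) ≤ N}, g j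

/-- `a_i / v_{i-1}`, with the conventions that it is `0` for `i = 0` (no death at `0`)
and that `a_i / 0 = ∞`. -/
noncomputable def backRatio (a v : ℕ → ℝ) (i : ℕ) : EReal :=
  if i = 0 then 0 else if v (i - 1) = 0 then ⊤ else ((a i / v (i - 1) : ℝ) : EReal)

/-- `R_i(v) = a_{i+1} + b_i - a_i / v_{i-1} - b_{i+1} v_i`; it is `-∞` where `v_{i-1} = 0`. -/
noncomputable def R (a b v : ℕ → ℝ) (i : ℕ) : EReal :=
  ((a (i + 1) + b i - b (i + 1) * v i : ℝ) : EReal) - backRatio a v i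

/-- `𝒱 = {v : v_i > 0 for 0 ≤ i < N - 1}`. -/
def V (N : ℕ∞) : Set (ℕ → ℝ) := {v | ∀ i : ℕ, (i : ℕ∞) + 1 < N → 0 < v i}

/-- The modified rate `ã_m = μ_m a_m / ∑_{k=m}^N μ_k`. -/
noncomputable def aTilde (N : ℕ∞) (a b : ℕ → ℝ) (m : ℕ) : ℝ :=
  mu a b m * a m / tailSum N (mu a b) m

/-- The local operator: `R` with `a_m` replaced by `ã_m`. -/
noncomputable def RTilde (N : ℕ∞) (a b : ℕ → ℝ) (m : ℕ) (v : ℕ → ℝ) (i : ℕ) : EReal :=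
  R (Function.update a m (aTilde N a b m)) b v i

/-- The part of the set of local test sequences that belongs to `m`.  Its elements have support
`{0, 1, …, m - 2}`, so that the parts are disjoint and `v` determines `m`. -/
def VTilde (a b : ℕ → ℝ) (m : ℕ) : Set (ℕ → ℝ) :=
  {v | (∀ i : ℕ, i + 2 ≤ m →
      a (i + 1) / (a (i + 2) + b (i + 1)) < v i ∧
      v i < (a (i + 1) + b i - (if i = 0 then 0 else a i / v (i - 1))) / b (i + 1)) ∧
    ∀ i : ℕ, m ≤ i + 1 → v i = 0}

/-- `I_i(f) = (μ_i a_i (f_i - f_{i-1}))⁻¹ ∑_{j=i}^N μ_j f_j` for `i ≥ 1`.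
Where `f_i = f_{i-1}`, the convention `I_i(f) = ∞` gives `I_i(f)⁻¹ = 0`, and this is also the
value of `(I N a b f i)⁻¹` in `ℝ`. -/
noncomputable def I (N : ℕ∞) (a b f : ℕ → ℝ) (i : ℕ) : ℝ :=
  tailSum N (fun j => mu a b j * f j) i / (mu a b i * a i * (f i - f (i - 1)))

/-- `f̄ = f - π(f)`, where `π = μ / Z` and `Z = ∑_{i ∈ E} μ_i`. -/
noncomputable def centered (N : ℕ∞) (a b f : ℕ → ℝ) (i : ℕ) : ℝ :=
  f i - integral N a b f / ∑' k : E N, mu a b k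

/-- `ℱ_I`: functions with `f_0 = 0`, positive on `E \ {0}` and strictly increasing on `E`, for
which `f̄` is defined, that is, `f ∈ L¹(μ)`. -/
def FI (N : ℕ∞) (a b : ℕ → ℝ) : Set (ℕ → ℝ) :=
  {f | f 0 = 0 ∧ (∀ i ∈ E N, 1 ≤ i → 0 < f i) ∧ StrictMonoOn f (E N) ∧ MemL1 N a b f}

/-- Functions with `f_0 = 0` for which there is `1 ≤ m ∈ E` with `f_i = f_{i ∧ m} > 0` for
`1 ≤ i ∈ E` and `f` strictly increasing on `{1, …, m}`. -/
def FITilde (N : ℕ∞) : Set (ℕ → ℝ) :=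
  {f | f 0 = 0 ∧ ∃ m ∈ E N, 1 ≤ m ∧ (∀ i ∈ E N, 1 ≤ i → f i = f (min i m) ∧ 0 < f i) ∧
    StrictMonoOn f (Set.Icc 1 m)}

/-- Functions in `L²(μ)` with `f_0 = 0` that are strictly increasing on `E`. -/
def FITilde' (N : ℕ∞) (a b : ℕ → ℝ) : Set (ℕ → ℝ) :=
  {f | MemL2 N a b f ∧ f 0 = 0 ∧ StrictMonoOn f (E N)}

end BirthDeath

namespace BirthDeath

open Filter Topology Finset

/-! ### The symmetric measure, tail sums and centering -/

section

/-! A mean-zero function is replaced by its flux, the sequence of its tail sums (up to sign, partial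
sums), which lives on edges. The Poincaré inequality then turns into a Hardy inequality `λ₁ ∑
H_{i+1}² / (μ_i b_i) ≤ ∑ (H_{i+1} - H_i)² / μ_i`, so that `λ₁` acts as a lowest Dirichlet eigenvalue
for `dualGenerator`. Both test operators are quotients `dualGenerator a b H i / H (i + 1)`: in the
difference form `H` has ratios governed by `v` (`dualGenerator_ratioFlux`), in the summation form
`H` is the tail sum of `f̄` (`dualGenerator_tailSum`).

One half of each formula holds for every test sequence. A positive supersolution bounds `λ₁` from
below (`le_spectralGap`), which settles both suprema. For the infima, the test flux is inserted into
the dual Poincaré inequality (`spectralGap_mul_flux_le`), or the test function into the Poincaré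
inequality itself (`spectralGap_le_iSup_inv_I`).

Sharpness comes from the shooting solution, along which the quotient is constantly the parameter. At
`λ₁` its flux is positive up to the last edge and nonnegative beyond it (`flux_pos`, `flux_nonneg`),
so it attains the suprema, apart from the summation form with `λ₁ = 0`, where any bounded increasing
function serves. At a parameter above `λ₁` positivity must fail, since otherwise the flux would be a
supersolution; by continuity some parameter in between has a flux with a first zero
(`exists_first_zero`), and cutting there gives local test sequences almost attaining the infima. -/

/-- The standing assumptions on the rates of an ergodic birth-death chain. -/
structure IsChain (N : ℕ∞) (a b : ℕ → ℝ) : Prop where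
  one_le : 1 ≤ N
  death_pos : ∀ i : ℕ, 1 ≤ i → (i : ℕ∞) ≤ N → 0 < a i
  birth_pos : ∀ i : ℕ, (i : ℕ∞) < N → 0 < b i
  birth_top : ∀ n : ℕ, (n : ℕ∞) = N → b n = 0
  summable_subtype : Summable fun i : E N => mu a b i

theorem succ_le_of_lt {N : ℕ∞} {i : ℕ} (hi : (i : ℕ∞) < N) : ((i + 1 : ℕ) : ℕ∞) ≤ N := by
  push_cast
  exact Order.add_one_le_of_lt hi

theorem lt_of_succ_le {N : ℕ∞} {i : ℕ} (hi : ((i + 1 : ℕ) : ℕ∞) ≤ N) : (i : ℕ∞) < N :=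
  lt_of_lt_of_le (by exact_mod_cast Nat.lt_succ_self i) hi

theorem le_of_le_nat {N : ℕ∞} {i j : ℕ} (hij : i ≤ j) (hj : (j : ℕ∞) ≤ N) : (i : ℕ∞) ≤ N :=
  le_trans (by exact_mod_cast hij) hj

theorem lt_of_lt_nat {N : ℕ∞} {i j : ℕ} (hij : i < j) (hj : (j : ℕ∞) ≤ N) : (i : ℕ∞) < N :=
  lt_of_lt_of_le (by exact_mod_cast hij) hj

namespace IsChain

variable {N : ℕ∞} {a b : ℕ → ℝ}

theorem mu_zero : mu a b 0 = 1 := by simp [mu]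

theorem mu_pos (h : IsChain N a b) {i : ℕ} (hi : (i : ℕ∞) ≤ N) : 0 < mu a b i := by
  refine div_pos (prod_pos fun j hj => ?_) (prod_pos fun j hj => ?_)
  · exact h.birth_pos j (lt_of_lt_nat (mem_range.1 hj) hi)
  · exact h.death_pos (j + 1) (by omega) (le_of_le_nat (mem_range.1 hj) hi)

/-- The factor `b N = 0` enters the product. This is what allows every sum over the state space to
be taken over all of `ℕ`. -/
theorem mu_eq_zero (h : IsChain N a b) {i : ℕ} (hi : ¬ (i : ℕ∞) ≤ N) : mu a b i = 0 := by
  rw [not_le] at hi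
  lift N to ℕ using hi.ne_top
  rw [mu, prod_eq_zero (i := N) (mem_range.2 (by exact_mod_cast hi)) (h.birth_top N rfl), zero_div]

theorem mu_nonneg (h : IsChain N a b) (i : ℕ) : 0 ≤ mu a b i := by
  by_cases hi : (i : ℕ∞) ≤ N
  · exact (h.mu_pos hi).le
  · exact (h.mu_eq_zero hi).ge

theorem mu_succ_mul (h : IsChain N a b) {i : ℕ} (hi : (i : ℕ∞) < N) :
    mu a b (i + 1) * a (i + 1) = mu a b i * b i := by
  have h1 := (h.death_pos (i + 1) (by omega) (succ_le_of_lt hi)).ne'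
  have h2 : ∏ j ∈ range i, a (j + 1) ≠ 0 := prod_ne_zero_iff.2 fun j hj =>
    (h.death_pos (j + 1) (by omega) (le_of_le_nat (mem_range.1 hj) hi.le)).ne'
  rw [mu, mu, prod_range_succ, prod_range_succ]
  field_simp

theorem edge_pos (h : IsChain N a b) {i : ℕ} (hi : (i : ℕ∞) < N) : 0 < mu a b i * b i :=
  mul_pos (h.mu_pos hi.le) (h.birth_pos i hi)

theorem edge_eq_zero (h : IsChain N a b) {i : ℕ} (hi : ¬ (i : ℕ∞) < N) : mu a b i * b i = 0 := by
  rcases (not_lt.1 hi).eq_or_lt with h1 | h1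
  · rw [h.birth_top i h1.symm, mul_zero]
  · rw [h.mu_eq_zero h1.not_ge, zero_mul]

theorem edge_nonneg (h : IsChain N a b) (i : ℕ) : 0 ≤ mu a b i * b i := by
  by_cases hi : (i : ℕ∞) < N
  · exact (h.edge_pos hi).le
  · exact (h.edge_eq_zero hi).ge

theorem support_mul_subset (h : IsChain N a b) (g : ℕ → ℝ) :
    (Function.support fun i => mu a b i * g i) ⊆ E N := by
  intro i hi
  by_contra hc
  exact hi (by simp [h.mu_eq_zero hc])

theorem support_edge_subset (h : IsChain N a b) (g : ℕ → ℝ) :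
    (Function.support fun i => mu a b i * b i * g i) ⊆ {i : ℕ | (i : ℕ∞) < N} := by
  intro i hi
  by_contra hc
  exact hi (by simp [h.edge_eq_zero hc])

theorem summable_vertex_iff (h : IsChain N a b) (g : ℕ → ℝ) :
    (Summable fun i : E N => mu a b i * g i) ↔ Summable fun i => mu a b i * g i :=
  exists_congr fun _ => hasSum_subtype_iff_of_support_subset (h.support_mul_subset g)

theorem summable_edge_iff (h : IsChain N a b) (g : ℕ → ℝ) :
    (Summable fun i : {i : ℕ | (i : ℕ∞) < N} => mu a b i * b i * g i) ↔
      Summable fun i => mu a b i * b i * g i :=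
  exists_congr fun _ => hasSum_subtype_iff_of_support_subset (h.support_edge_subset g)

theorem summable_mu (h : IsChain N a b) : Summable (mu a b) := by
  have := (h.summable_vertex_iff fun _ => 1).1 (by simpa using h.summable_subtype)
  simpa using this

theorem integral_eq (h : IsChain N a b) (f : ℕ → ℝ) :
    integral N a b f = ∑' i, mu a b i * f i :=
  tsum_subtype_eq_of_support_subset (h.support_mul_subset f)

theorem mass_eq (h : IsChain N a b) : ∑' i : E N, mu a b i = ∑' i, mu a b i := by
  simpa [integral] using h.integral_eq fun _ => 1

theorem mass_pos (h : IsChain N a b) : 0 < ∑' i, mu a b i :=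
  h.summable_mu.tsum_pos h.mu_nonneg 0 (h.mu_pos (by simp))

theorem dirichletForm_eq (h : IsChain N a b) (f : ℕ → ℝ) :
    dirichletForm N a b f = ∑' i, mu a b i * b i * (f (i + 1) - f i) ^ 2 :=
  tsum_subtype_eq_of_support_subset (h.support_edge_subset fun i => (f (i + 1) - f i) ^ 2)

theorem mem_maxDomain_iff (h : IsChain N a b) (f : ℕ → ℝ) :
    f ∈ maxDomain N a b ↔ (Summable fun i => mu a b i * f i ^ 2) ∧
      Summable fun i => mu a b i * b i * (f (i + 1) - f i) ^ 2 := by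
  rw [maxDomain, Set.mem_ofPred_eq, MemL2, h.summable_vertex_iff fun i => f i ^ 2,
    h.summable_edge_iff fun i => (f (i + 1) - f i) ^ 2]

theorem tailSum_add (h : IsChain N a b) {g : ℕ → ℝ} (hg : Summable fun i => mu a b i * g i)
    (i : ℕ) :
    ∑ j ∈ range i, mu a b j * g j + tailSum N (fun j => mu a b j * g j) i
      = ∑' j, mu a b j * g j := by
  rw [← hg.sum_add_tsum_nat_add i, tailSum,
    tsum_subtype {j : ℕ | i ≤ j ∧ (j : ℕ∞) ≤ N} fun j => mu a b j * g j]
  congr 1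
  rw [← (hg.indicator _).sum_add_tsum_nat_add i, sum_eq_zero, zero_add]
  · refine tsum_congr fun j => ?_
    by_cases hj : ((j + i : ℕ) : ℕ∞) ≤ N
    · rw [Set.indicator_of_mem]
      exact ⟨by omega, hj⟩
    · rw [Set.indicator_of_notMem (fun hc => hj hc.2), h.mu_eq_zero hj, zero_mul]
  · intro j hj
    exact Set.indicator_of_notMem (fun hc => absurd hc.1 (by simpa using hj)) _

theorem tailSum_mu_add (h : IsChain N a b) (i : ℕ) :
    ∑ j ∈ range i, mu a b j + tailSum N (mu a b) i = ∑' j, mu a b j := by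
  simpa using h.tailSum_add (g := fun _ => 1) (by simpa using h.summable_mu) i

theorem mu_add_tailSum (h : IsChain N a b) (i : ℕ) :
    mu a b i + tailSum N (mu a b) (i + 1) = tailSum N (mu a b) i := by
  have h1 := h.tailSum_mu_add i
  have h2 := h.tailSum_mu_add (i + 1)
  rw [sum_range_succ] at h2
  linarith

theorem tailSum_mu_nonneg (h : IsChain N a b) (i : ℕ) : 0 ≤ tailSum N (mu a b) i :=
  tsum_nonneg fun j => h.mu_nonneg j

theorem mu_le_tailSum (h : IsChain N a b) (i : ℕ) : mu a b i ≤ tailSum N (mu a b) i := by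
  linarith [h.mu_add_tailSum i, h.tailSum_mu_nonneg (i + 1)]

theorem tailSum_mu_pos (h : IsChain N a b) {i : ℕ} (hi : (i : ℕ∞) ≤ N) :
    0 < tailSum N (mu a b) i :=
  (h.mu_pos hi).trans_le (h.mu_le_tailSum i)

theorem mu_lt_tailSum (h : IsChain N a b) {i : ℕ} (hi : (i : ℕ∞) < N) :
    mu a b i < tailSum N (mu a b) i := by
  linarith [h.mu_add_tailSum i, h.tailSum_mu_pos (succ_le_of_lt hi)]

theorem summable_of_sq (h : IsChain N a b) {f : ℕ → ℝ} (hf : Summable fun i => mu a b i * f i ^ 2) :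
    Summable fun i => mu a b i * |f i| := by
  refine Summable.of_nonneg_of_le (fun i => mul_nonneg (h.mu_nonneg i) (abs_nonneg _))
    (fun i => ?_) (h.summable_mu.add hf)
  have := h.mu_nonneg i
  nlinarith [sq_nonneg (|f i| - 1), sq_abs (f i), mul_nonneg this (sq_nonneg (|f i| - 1)),
    mul_nonneg this (abs_nonneg (f i))]

theorem summable_of_abs (h : IsChain N a b) {f : ℕ → ℝ} (hf : Summable fun i => mu a b i * |f i|) :
    Summable fun i => mu a b i * f i := by
  refine Summable.of_norm (hf.congr fun i => ?_)
  rw [norm_mul, Real.norm_eq_abs, Real.norm_eq_abs, abs_of_nonneg (h.mu_nonneg i)]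

/-! ### Centering -/

theorem centered_eq (h : IsChain N a b) (f : ℕ → ℝ) (i : ℕ) :
    centered N a b f i = f i - (∑' j, mu a b j * f j) / ∑' j, mu a b j := by
  rw [centered, h.integral_eq, h.mass_eq]

theorem centered_sub (f : ℕ → ℝ) (i j : ℕ) :
    centered N a b f i - centered N a b f j = f i - f j := by
  simp [centered]

theorem hasSum_centered (h : IsChain N a b) {f : ℕ → ℝ} (hf : Summable fun i => mu a b i * f i) :
    HasSum (fun i => mu a b i * centered N a b f i) 0 := by
  have h1 := hf.hasSum.sub (h.summable_mu.hasSum.mul_right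
    ((∑' j, mu a b j * f j) / ∑' j, mu a b j))
  rw [mul_div_cancel₀ _ h.mass_pos.ne', sub_self] at h1
  rwa [show (fun i => mu a b i * centered N a b f i) = fun i => mu a b i * f i -
    mu a b i * ((∑' j, mu a b j * f j) / ∑' j, mu a b j) from
      funext fun i => by rw [h.centered_eq, mul_sub]]

theorem summable_centered_sq (h : IsChain N a b) {f : ℕ → ℝ}
    (hf : Summable fun i => mu a b i * f i ^ 2) :
    Summable fun i => mu a b i * centered N a b f i ^ 2 := by
  set c := (∑' j, mu a b j * f j) / ∑' j, mu a b j with hc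
  have h1 := (hf.sub ((h.summable_of_abs (h.summable_of_sq hf)).mul_right (2 * c))).add
    (h.summable_mu.mul_right (c ^ 2))
  refine h1.congr fun i => ?_
  rw [h.centered_eq, ← hc]
  ring

/-- The tail sums of `f̄` are the negatives of its partial sums. -/
theorem tailSum_centered (h : IsChain N a b) {f : ℕ → ℝ} (hf : Summable fun i => mu a b i * f i)
    (i : ℕ) :
    tailSum N (fun j => mu a b j * centered N a b f j) i
      = -∑ j ∈ range i, mu a b j * centered N a b f j := by
  have h0 := h.hasSum_centered hf
  have := h.tailSum_add h0.summable i
  rw [h0.tsum_eq] at this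
  linarith

end IsChain

end

/-! ### The Poincaré inequality and its dual form on fluxes -/

section

theorem two_mul_le_sq_div_add {t x y : ℝ} (ht : 0 < t) : 2 * (x * y) ≤ x ^ 2 / t + t * y ^ 2 := by
  have : x ^ 2 / t + t * y ^ 2 - 2 * (x * y) = (x - t * y) ^ 2 / t := by
    field_simp
    ring
  have h2 : 0 ≤ (x - t * y) ^ 2 / t := by positivity
  linarith

/-- Summation by parts. -/
theorem sum_mul_sub_eq (φ G : ℕ → ℝ) (h0 : φ 0 = 0) (m : ℕ) :
    ∑ i ∈ range m, φ (i + 1) * (G (i + 1) - G i)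
      = φ m * G m - ∑ i ∈ range m, (φ (i + 1) - φ i) * G i := by
  induction m with
  | zero => simp [h0]
  | succ m ih =>
    rw [sum_range_succ, sum_range_succ, ih]
    ring

namespace IsChain

variable {N : ℕ∞} {a b : ℕ → ℝ}

/-- For functions frozen from `m` on, the states beyond `m` merge into one atom of mass `tailSum N
(mu a b) m`; this is the origin of `ã_m`. -/
theorem hasSum_of_eventually_const (h : IsChain N a b) {u : ℕ → ℝ} {m : ℕ}
    (hu : ∀ i, m ≤ i → u i = u m) :
    HasSum (fun i => mu a b i * u i)
      (∑ i ∈ range m, mu a b i * u i + tailSum N (mu a b) m * u m) := by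
  have h1 : HasSum (fun i => mu a b i * (u i - u m)) (∑ i ∈ range m, mu a b i * (u i - u m)) :=
    hasSum_sum_of_ne_finset_zero fun i hi => by
      rw [hu i (by simpa using hi), sub_self, mul_zero]
  have h2 := h1.add (h.summable_mu.hasSum.mul_right (u m))
  have h3 := h.tailSum_mu_add m
  rw [show (∑ i ∈ range m, mu a b i * u i + tailSum N (mu a b) m * u m)
    = ∑ i ∈ range m, mu a b i * (u i - u m) + (∑' i, mu a b i) * u m by
      rw [← h3]; simp only [mul_sub, sum_sub_distrib, add_mul, sum_mul]; ring]
  rwa [show (fun i => mu a b i * u i) = fun i => mu a b i * (u i - u m) + mu a b i * u m from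
    funext fun i => by ring]

theorem hasSum_edge_of_eventually_const {f : ℕ → ℝ} {m : ℕ} (hf : ∀ i, m ≤ i → f i = f m) :
    HasSum (fun i => mu a b i * b i * (f (i + 1) - f i) ^ 2)
      (∑ i ∈ range m, mu a b i * b i * (f (i + 1) - f i) ^ 2) :=
  hasSum_sum_of_ne_finset_zero fun i hi => by
    have : m ≤ i := by simpa using hi
    rw [hf i this, hf (i + 1) (by omega)]
    ring

theorem dirichletForm_nonneg (h : IsChain N a b) (f : ℕ → ℝ) : 0 ≤ dirichletForm N a b f := by
  rw [h.dirichletForm_eq]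
  exact tsum_nonneg fun i => mul_nonneg (h.edge_nonneg i) (sq_nonneg _)

theorem spectralGap_nonneg (h : IsChain N a b) : 0 ≤ spectralGap N a b :=
  Real.sInf_nonneg (by rintro x ⟨f, -, -, -, rfl⟩; exact h.dirichletForm_nonneg f)

theorem mem_normalized (h : IsChain N a b) {f : ℕ → ℝ} (hf : f ∈ maxDomain N a b)
    (h0 : ∑' i, mu a b i * f i = 0) (hpos : 0 < ∑' i, mu a b i * f i ^ 2) :
    dirichletForm N a b f / (∑' i, mu a b i * f i ^ 2) ∈
      {x | ∃ f ∈ maxDomain N a b, integral N a b f = 0 ∧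
        integral N a b (fun i => f i ^ 2) = 1 ∧ x = dirichletForm N a b f} := by
  set s := ∑' i, mu a b i * f i ^ 2 with hs
  have hr : (Real.sqrt s)⁻¹ ^ 2 = s⁻¹ := by rw [inv_pow, Real.sq_sqrt hpos.le]
  rw [h.mem_maxDomain_iff] at hf
  have e1 : (fun i => mu a b i * ((Real.sqrt s)⁻¹ * f i) ^ 2)
      = fun i => s⁻¹ * (mu a b i * f i ^ 2) := by
    funext i; rw [mul_pow, hr]; ring
  have e2 : (fun i => mu a b i * b i * ((Real.sqrt s)⁻¹ * f (i + 1) - (Real.sqrt s)⁻¹ * f i) ^ 2)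
      = fun i => s⁻¹ * (mu a b i * b i * (f (i + 1) - f i) ^ 2) := by
    funext i; rw [← mul_sub, mul_pow, hr]; ring
  refine ⟨fun i => (Real.sqrt s)⁻¹ * f i, ?_, ?_, ?_, ?_⟩
  · rw [h.mem_maxDomain_iff, e1, e2]
    exact ⟨hf.1.mul_left _, hf.2.mul_left _⟩
  · rw [h.integral_eq, show (fun i => mu a b i * ((Real.sqrt s)⁻¹ * f i))
      = fun i => (Real.sqrt s)⁻¹ * (mu a b i * f i) from funext fun i => by ring,
      tsum_mul_left, h0, mul_zero]
  · rw [h.integral_eq, e1, tsum_mul_left, ← hs, inv_mul_cancel₀ hpos.ne']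
  · rw [h.dirichletForm_eq, h.dirichletForm_eq, e2, tsum_mul_left, div_eq_inv_mul]

/-- The Poincaré inequality with constant `λ₁`. -/
theorem spectralGap_mul_le (h : IsChain N a b) {f : ℕ → ℝ} (hf : f ∈ maxDomain N a b)
    (h0 : ∑' i, mu a b i * f i = 0) :
    spectralGap N a b * ∑' i, mu a b i * f i ^ 2 ≤ dirichletForm N a b f := by
  rcases (tsum_nonneg fun i => mul_nonneg (h.mu_nonneg i) (sq_nonneg (f i)) :
    0 ≤ ∑' i, mu a b i * f i ^ 2).eq_or_lt with h1 | h1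
  · rw [← h1, mul_zero]
    exact h.dirichletForm_nonneg f
  · rw [← le_div_iff₀ h1]
    refine csInf_le ⟨0, ?_⟩ (h.mem_normalized hf h0 h1)
    rintro x ⟨f, -, -, -, rfl⟩
    exact h.dirichletForm_nonneg f

theorem centered_mem_maxDomain (h : IsChain N a b) {f : ℕ → ℝ} (hf : f ∈ maxDomain N a b) :
    centered N a b f ∈ maxDomain N a b := by
  rw [h.mem_maxDomain_iff] at hf ⊢
  refine ⟨h.summable_centered_sq hf.1, ?_⟩
  simpa only [centered_sub] using hf.2

theorem mem_maxDomain_of_eventually_const (h : IsChain N a b) {f : ℕ → ℝ} {m : ℕ}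
    (hf : ∀ i, m ≤ i → f i = f m) : f ∈ maxDomain N a b := by
  rw [h.mem_maxDomain_iff]
  exact ⟨(h.hasSum_of_eventually_const (u := fun i => f i ^ 2) (m := m) fun i hi => by
    simp only [hf i hi]).summable, (hasSum_edge_of_eventually_const hf).summable⟩

/-- The dual form of the Poincaré inequality, for fluxes supported on the first `m` edges. -/
theorem spectralGap_mul_flux_le (h : IsChain N a b) {φ : ℕ → ℝ} (h0 : φ 0 = 0) {m : ℕ}
    (hm : (m : ℕ∞) ≤ N) :
    spectralGap N a b * ∑ i ∈ range m, φ (i + 1) ^ 2 / (mu a b i * b i)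
      ≤ ∑ i ∈ range m, (φ (i + 1) - φ i) ^ 2 / mu a b i + φ m ^ 2 / tailSum N (mu a b) m := by
  -- The function whose weighted gradient on the first `m` edges is `φ`, frozen afterwards.
  set f : ℕ → ℝ := fun i => ∑ j ∈ range (min i m), φ (j + 1) / (mu a b j * b j) with hf
  have hfc : ∀ i, m ≤ i → f i = f m := fun i hi => by simp [hf, hi]
  have hfs : ∀ i ∈ range m, f (i + 1) - f i = φ (i + 1) / (mu a b i * b i) := fun i hi => by
    have := mem_range.1 hi
    simp [hf, this.le, Nat.succ_le_of_lt this, sum_range_succ]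
  have hfd := h.mem_maxDomain_of_eventually_const hfc
  set G := centered N a b f with hG
  have hGc : ∀ i, m ≤ i → G i = G m := fun i hi => by simp [hG, centered, hfc i hi]
  have hsum : HasSum (fun i => mu a b i * G i) 0 :=
    h.hasSum_centered (h.hasSum_of_eventually_const hfc).summable
  have hgap := h.spectralGap_mul_le (h.centered_mem_maxDomain hfd) hsum.tsum_eq
  rw [h.dirichletForm_eq, (hasSum_edge_of_eventually_const hGc).tsum_eq,
    (h.hasSum_of_eventually_const (u := fun i => G i ^ 2) (m := m) fun i hi => by
      simp only [hGc i hi]).tsum_eq] at hgap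
  have hX : ∑ i ∈ range m, mu a b i * b i * (G (i + 1) - G i) ^ 2
      = ∑ i ∈ range m, φ (i + 1) ^ 2 / (mu a b i * b i) := sum_congr rfl fun i hi => by
    have := (h.edge_pos (lt_of_lt_nat (mem_range.1 hi) hm)).ne'
    rw [hG, centered_sub, hfs i hi]
    field_simp
  have hY : ∑ i ∈ range m, φ (i + 1) * (G (i + 1) - G i)
      = ∑ i ∈ range m, φ (i + 1) ^ 2 / (mu a b i * b i) := sum_congr rfl fun i hi => by
    rw [hG, centered_sub, hfs i hi]
    ring
  rw [sum_mul_sub_eq φ G h0] at hY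
  rw [hX] at hgap
  set l := spectralGap N a b
  -- With `X` the sum on the left of the goal, Young's inequality bounds `2 l X` by the right side
  -- plus `l²` times the variance of `f`. The Poincaré inequality bounds the latter by `l X`.
  have h1 : -(2 * l * ∑ i ∈ range m, (φ (i + 1) - φ i) * G i)
      ≤ ∑ i ∈ range m, (φ (i + 1) - φ i) ^ 2 / mu a b i
        + l ^ 2 * ∑ i ∈ range m, mu a b i * G i ^ 2 := by
    rw [mul_sum, mul_sum, ← sum_neg_distrib, ← sum_add_distrib]
    refine sum_le_sum fun i hi => ?_
    have := two_mul_le_sq_div_add (x := φ (i + 1) - φ i) (y := -(l * G i))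
      (h.mu_pos (lt_of_lt_nat (mem_range.1 hi) hm).le)
    linarith
  have h2 := two_mul_le_sq_div_add (x := φ m) (y := l * G m) (h.tailSum_mu_pos hm)
  have hl : 0 ≤ l := h.spectralGap_nonneg
  have h3 := mul_le_mul_of_nonneg_left hgap hl
  have h4 := congrArg (fun t => 2 * l * t) hY
  linarith

/-- A function of mean zero that is not identically zero witnesses that `λ₁` is the infimum of a
non-empty set. -/
theorem spectralGap_set_nonempty (h : IsChain N a b) :
    {x | ∃ f ∈ maxDomain N a b, integral N a b f = 0 ∧
        integral N a b (fun i => f i ^ 2) = 1 ∧ x = dirichletForm N a b f}.Nonempty := by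
  set f : ℕ → ℝ := fun i => if i = 0 then 1 else 0 with hf
  have hfc : ∀ i, 1 ≤ i → f i = f 1 := fun i hi => by
    simp [hf, Nat.pos_iff_ne_zero.1 hi]
  have hd := h.mem_maxDomain_of_eventually_const hfc
  have hs := h.hasSum_of_eventually_const hfc
  have hcd := h.centered_mem_maxDomain hd
  refine ⟨_, h.mem_normalized hcd (h.hasSum_centered hs.summable).tsum_eq ?_⟩
  refine ((h.mem_maxDomain_iff _).1 hcd).1.tsum_pos
    (fun i => mul_nonneg (h.mu_nonneg i) (sq_nonneg _)) 0 ?_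
  refine mul_pos (h.mu_pos (by simp)) (pow_pos ?_ 2)
  have hZ := h.tailSum_mu_add 1
  have hT := h.tailSum_mu_pos (i := 1) (by exact_mod_cast h.one_le)
  -- The centered indicator of `0` takes the value `1 - 1 / Z` there, positive because `Z` exceeds
  -- `μ_0 = 1`.
  rw [h.centered_eq, hs.tsum_eq, ← hZ]
  simp only [hf, range_one, sum_singleton, mu_zero]
  rw [sub_pos, div_lt_iff₀ (by linarith)]
  norm_num
  exact hT

end IsChain

end

/-! ### The shooting solution and Barta's principle -/

section

/-- The solution `(H, g)` of the shooting problem `H_0 = 0`, `g_0 = 1`, `H_{i+1} = H_i + μ_i g_i`,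
`μ_i b_i (g_i - g_{i+1}) = c H_{i+1}`: here `-g` is a formal eigenfunction and `H` its flux. -/
noncomputable def shoot (a b : ℕ → ℝ) (c : ℝ) : ℕ → ℝ × ℝ
  | 0 => (0, 1)
  | i + 1 => ((shoot a b c i).1 + mu a b i * (shoot a b c i).2,
      (shoot a b c i).2 - c * ((shoot a b c i).1 + mu a b i * (shoot a b c i).2)
        / (mu a b i * b i))

/-- The flux of the shooting solution. -/
noncomputable def flux (a b : ℕ → ℝ) (c : ℝ) (i : ℕ) : ℝ := (shoot a b c i).1

/-- The slope of the flux of the shooting solution. -/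
noncomputable def slope (a b : ℕ → ℝ) (c : ℝ) (i : ℕ) : ℝ := (shoot a b c i).2

/-- The generator of the dual chain, acting on fluxes indexed so that `H (i + 1)` lives on the edge
from `i` to `i + 1`. -/
def dualGenerator (a b H : ℕ → ℝ) (i : ℕ) : ℝ :=
  (a (i + 1) + b i) * H (i + 1) - b i * H i - a (i + 1) * H (i + 2)

variable {a b : ℕ → ℝ} {c : ℝ}

theorem flux_zero : flux a b c 0 = 0 := rfl

theorem slope_zero : slope a b c 0 = 1 := rfl

theorem flux_succ (i : ℕ) : flux a b c (i + 1) = flux a b c i + mu a b i * slope a b c i := rfl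

theorem slope_succ (i : ℕ) :
    slope a b c (i + 1) = slope a b c i - c * flux a b c (i + 1) / (mu a b i * b i) := rfl

theorem flux_one : flux a b c 1 = 1 := by
  simp [flux_succ, flux_zero, slope_zero, IsChain.mu_zero]

theorem continuous_flux_slope (a b : ℕ → ℝ) (i : ℕ) :
    Continuous (fun c => flux a b c i) ∧ Continuous fun c => slope a b c i := by
  induction i with
  | zero => exact ⟨continuous_const, continuous_const⟩
  | succ i ih =>
    obtain ⟨h1, h2⟩ := ih
    have h3 : Continuous fun c => flux a b c (i + 1) := by
      simp only [flux_succ]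
      fun_prop
    refine ⟨h3, ?_⟩
    simp only [slope_succ]
    fun_prop

theorem slope_of_zero (i : ℕ) : slope a b 0 i = 1 := by
  induction i with
  | zero => rfl
  | succ i ih => simp [slope_succ, ih]

theorem flux_eq_sum (i : ℕ) : flux a b c i = ∑ j ∈ range i, mu a b j * slope a b c j := by
  induction i with
  | zero => rfl
  | succ i ih => rw [flux_succ, sum_range_succ, ih]

/-- The energy identity for the shooting solution. -/
theorem sum_mul_slope_sq (k : ℕ) :
    ∑ i ∈ range k, mu a b i * slope a b c i ^ 2
      = flux a b c k * slope a b c k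
        + c * ∑ i ∈ range k, flux a b c (i + 1) ^ 2 / (mu a b i * b i) := by
  induction k with
  | zero => simp [flux_zero]
  | succ k ih =>
    rw [sum_range_succ, sum_range_succ, ih, slope_succ, flux_succ]
    ring

namespace IsChain

variable {N : ℕ∞}

/-- Detailed balance `μ_{i+1} a_{i+1} = μ_i b_i` puts the dual generator in divergence form. -/
theorem edge_mul_sub (h : IsChain N a b) (H : ℕ → ℝ) {i : ℕ} (hi : (i : ℕ∞) < N) :
    mu a b i * b i * ((H (i + 1) - H i) / mu a b i - (H (i + 2) - H (i + 1)) / mu a b (i + 1))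
      = dualGenerator a b H i := by
  have h1 := (h.mu_pos hi.le).ne'
  have h2 := (h.mu_pos (succ_le_of_lt hi)).ne'
  have e1 : mu a b i * b i * ((H (i + 1) - H i) / mu a b i) = b i * (H (i + 1) - H i) := by
    field_simp
  have e2 : mu a b i * b i * ((H (i + 2) - H (i + 1)) / mu a b (i + 1))
      = a (i + 1) * (H (i + 2) - H (i + 1)) := by
    rw [← h.mu_succ_mul hi]
    field_simp
  rw [mul_sub, e1, e2, dualGenerator]
  ring

theorem slope_eq (h : IsChain N a b) {i : ℕ} (hi : (i : ℕ∞) ≤ N) :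
    slope a b c i = (flux a b c (i + 1) - flux a b c i) / mu a b i := by
  rw [flux_succ, add_sub_cancel_left, mul_div_cancel_left₀ _ (h.mu_pos hi).ne']

theorem edge_mul_slope_sub (h : IsChain N a b) {i : ℕ} (hi : (i : ℕ∞) < N) :
    mu a b i * b i * (slope a b c i - slope a b c (i + 1)) = c * flux a b c (i + 1) := by
  rw [slope_succ, sub_sub_cancel, mul_div_cancel₀ _ (h.edge_pos hi).ne']

theorem dualGenerator_flux (h : IsChain N a b) {i : ℕ} (hi : (i : ℕ∞) < N) :
    dualGenerator a b (flux a b c) i = c * flux a b c (i + 1) := by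
  rw [← h.edge_mul_sub _ hi, ← h.slope_eq hi.le, ← h.slope_eq (succ_le_of_lt hi),
    h.edge_mul_slope_sub hi]

/-- In the dual Poincaré inequality for the shooting flux at `λ₁`, the energy identity cancels the
bulk sums and leaves only the boundary terms. -/
theorem flux_mul_tail_nonneg (h : IsChain N a b) {k : ℕ} (hk : (k : ℕ∞) ≤ N) :
    0 ≤ flux a b (spectralGap N a b) k * slope a b (spectralGap N a b) k
      + flux a b (spectralGap N a b) k ^ 2 / tailSum N (mu a b) k := by
  have h1 := h.spectralGap_mul_flux_le (φ := flux a b (spectralGap N a b)) flux_zero hk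
  have h2 := sum_mul_slope_sq (a := a) (b := b) (c := spectralGap N a b) k
  have h3 : ∑ i ∈ range k, (flux a b (spectralGap N a b) (i + 1)
      - flux a b (spectralGap N a b) i) ^ 2 / mu a b i
      = ∑ i ∈ range k, mu a b i * slope a b (spectralGap N a b) i ^ 2 :=
    sum_congr rfl fun i hi => by
      have := (h.mu_pos (lt_of_lt_nat (mem_range.1 hi) hk).le).ne'
      rw [flux_succ, add_sub_cancel_left]
      field_simp
  rw [h3, h2] at h1
  linarith

/-- With `T_k` the tail mass, dividing the boundary inequality by `H_k > 0` gives `g_k ≥ -H_k /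
T_k`, whence `H_{k+1} ≥ H_k (1 - μ_k / T_k)`. Below the upper end `μ_k < T_k` strictly. -/
theorem flux_pos (h : IsChain N a b) {k : ℕ} (hk : ((k + 1 : ℕ) : ℕ∞) ≤ N) :
    0 < flux a b (spectralGap N a b) (k + 1) := by
  induction k with
  | zero => rw [flux_one]; exact one_pos
  | succ k ih =>
    have hp := ih (le_of_le_nat (by omega) hk)
    have h1 := h.flux_mul_tail_nonneg (le_of_le_nat (Nat.le_succ (k + 1)) hk)
    have hlt := h.mu_lt_tailSum (lt_of_succ_le hk)
    have hmu := h.mu_pos (lt_of_succ_le hk).le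
    rw [pow_two, mul_div_assoc, ← mul_add] at h1
    have h2 := nonneg_of_mul_nonneg_right h1 hp
    rw [flux_succ]
    set x := flux a b (spectralGap N a b) (k + 1)
    have h3 : mu a b (k + 1) * (x / tailSum N (mu a b) (k + 1)) < x := by
      rw [mul_div_assoc', div_lt_iff₀ (hmu.trans hlt), mul_comm]
      exact mul_lt_mul_of_pos_left hlt hp
    nlinarith [mul_nonneg hmu.le h2]

/-- At the upper end the tail mass may equal `μ_k`, so the same argument yields only a weak
inequality. -/
theorem flux_nonneg (h : IsChain N a b) {k : ℕ} (hk : (k : ℕ∞) ≤ N) :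
    0 ≤ flux a b (spectralGap N a b) (k + 1) := by
  rcases hk.lt_or_eq with hk | hk
  · exact (h.flux_pos (succ_le_of_lt hk)).le
  rcases k with _ | k
  · rw [flux_one]; exact zero_le_one
  have hp := h.flux_pos hk.le
  have h1 := h.flux_mul_tail_nonneg hk.le
  have hmu := h.mu_pos hk.le
  have hle := h.mu_le_tailSum (k + 1)
  rw [pow_two, mul_div_assoc, ← mul_add] at h1
  have h2 := nonneg_of_mul_nonneg_right h1 hp
  rw [flux_succ]
  set x := flux a b (spectralGap N a b) (k + 1)
  have h3 : mu a b (k + 1) * (x / tailSum N (mu a b) (k + 1)) ≤ x := by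
    rw [mul_div_assoc', div_le_iff₀ (hmu.trans_le hle), mul_comm]
    exact mul_le_mul_of_nonneg_left hle hp.le
  nlinarith [mul_nonneg hmu.le h2]

/-! ### Positive supersolutions bound the spectral gap from below -/

/-- Picone's identity: the defect is the square `(A y - B x)² / (m A B)`. -/
theorem sq_sub_ge_of_pos {x y A B m : ℝ} (hA : 0 < A) (hB : 0 < B) (hm : 0 < m) :
    y ^ 2 * ((B - A) / m) / B - x ^ 2 * ((B - A) / m) / A ≤ (y - x) ^ 2 / m := by
  have e : (y - x) ^ 2 / m - (y ^ 2 * ((B - A) / m) / B - x ^ 2 * ((B - A) / m) / A)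
      = (A * y - B * x) ^ 2 / (m * A * B) := by
    field_simp
    ring
  have : 0 ≤ (A * y - B * x) ^ 2 / (m * A * B) := by positivity
  linarith

/-- Picone's inequality summed over vertices. The last summand on the left is the boundary term that
makes the induction close. -/
theorem ground_state_le (h : IsChain N a b) {H φ : ℕ → ℝ} (hH0 : H 0 = 0) (hφ0 : φ 0 = 0)
    (hH : ∀ i : ℕ, 1 ≤ i → (i : ℕ∞) ≤ N → 0 < H i) {M : ℕ} (hM : ((M + 1 : ℕ) : ℕ∞) ≤ N) :
    ∑ i ∈ range M, φ (i + 1) ^ 2 / H (i + 1) *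
        ((H (i + 1) - H i) / mu a b i - (H (i + 2) - H (i + 1)) / mu a b (i + 1))
      + φ (M + 1) ^ 2 * ((H (M + 1) - H M) / mu a b M) / H (M + 1)
      ≤ ∑ i ∈ range (M + 1), (φ (i + 1) - φ i) ^ 2 / mu a b i := by
  induction M with
  | zero =>
    have h1 := (hH 1 le_rfl (by simpa using hM)).ne'
    simp [hH0, hφ0, mu_zero, h1]
  | succ M ih =>
    have hM' := le_of_le_nat (Nat.le_succ _) hM
    rw [sum_range_succ, sum_range_succ _ (M + 1)]
    have h1 := sq_sub_ge_of_pos (x := φ (M + 1)) (y := φ (M + 2)) (hH (M + 1) (by omega) hM')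
      (hH (M + 2) (by omega) hM) (h.mu_pos hM')
    have h2 := ih hM'
    have e : φ (M + 1) ^ 2 / H (M + 1) * ((H (M + 1) - H M) / mu a b M
        - (H (M + 2) - H (M + 1)) / mu a b (M + 1))
        = φ (M + 1) ^ 2 * ((H (M + 1) - H M) / mu a b M) / H (M + 1)
          - φ (M + 1) ^ 2 * ((H (M + 2) - H (M + 1)) / mu a b (M + 1)) / H (M + 1) := by ring
    rw [e]
    linarith

/-- Hardy's inequality on finitely supported fluxes, from a positive supersolution. -/
theorem flux_le_of_supersolution (h : IsChain N a b) {H φ : ℕ → ℝ} (hH0 : H 0 = 0) (hφ0 : φ 0 = 0)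
    (hH : ∀ i : ℕ, 1 ≤ i → (i : ℕ∞) ≤ N → 0 < H i)
    (hHN : ∀ n : ℕ, (n : ℕ∞) = N → 0 ≤ H (n + 1))
    (hc : ∀ i : ℕ, (i : ℕ∞) < N → c * H (i + 1) ≤ dualGenerator a b H i)
    {M : ℕ} (hM : (M : ℕ∞) ≤ N) (hφM : φ (M + 1) = 0) :
    c * ∑ i ∈ range M, φ (i + 1) ^ 2 / (mu a b i * b i)
      ≤ ∑ i ∈ range (M + 1), (φ (i + 1) - φ i) ^ 2 / mu a b i := by
  have hterm : ∀ i ∈ range M, c * (φ (i + 1) ^ 2 / (mu a b i * b i)) ≤ φ (i + 1) ^ 2 / H (i + 1) *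
      ((H (i + 1) - H i) / mu a b i - (H (i + 2) - H (i + 1)) / mu a b (i + 1)) := fun i hi => by
    have hi' := lt_of_lt_nat (mem_range.1 hi) hM
    have hp := hH (i + 1) (by omega) (succ_le_of_lt hi')
    have hκ := h.edge_pos hi'
    have h1 := hc i hi'
    rw [← h.edge_mul_sub H hi'] at h1
    set W := (H (i + 1) - H i) / mu a b i - (H (i + 2) - H (i + 1)) / mu a b (i + 1)
    have h2 : c / (mu a b i * b i) ≤ W / H (i + 1) := by
      rw [div_le_div_iff₀ hκ hp]
      linarith
    calc c * (φ (i + 1) ^ 2 / (mu a b i * b i)) = φ (i + 1) ^ 2 * (c / (mu a b i * b i)) := by ring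
      _ ≤ φ (i + 1) ^ 2 * (W / H (i + 1)) := mul_le_mul_of_nonneg_left h2 (sq_nonneg _)
      _ = _ := by ring
  rw [mul_sum]
  refine (sum_le_sum hterm).trans ?_
  rcases M with _ | M
  · simp only [range_zero, sum_empty]
    exact sum_nonneg fun i hi => div_nonneg (sq_nonneg _) (h.mu_nonneg i)
  have h1 := h.ground_state_le hH0 hφ0 hH hM
  rw [sum_range_succ _ (M + 1), sum_range_succ _ M, hφM]
  have hμ := h.mu_pos hM
  have hA := hH (M + 1) (by omega) hM
  -- The last vertex contributes a term with the sign of `H (M + 2)`, which lies past the end when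
  -- `M + 1 = N`; hence the separate hypothesis `hHN`.
  have hB : 0 ≤ H (M + 2) := by
    rcases hM.lt_or_eq with h2 | h2
    · exact (hH (M + 2) (by omega) (succ_le_of_lt h2)).le
    · exact hHN _ h2
  have e : φ (M + 1) ^ 2 / H (M + 1) * ((H (M + 1) - H M) / mu a b M
      - (H (M + 2) - H (M + 1)) / mu a b (M + 1))
      = φ (M + 1) ^ 2 * ((H (M + 1) - H M) / mu a b M) / H (M + 1)
        + (0 - φ (M + 1)) ^ 2 / mu a b (M + 1)
        - φ (M + 1) ^ 2 * H (M + 2) / (H (M + 1) * mu a b (M + 1)) := by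
    field_simp
    ring
  rw [e]
  have : 0 ≤ φ (M + 1) ^ 2 * H (M + 2) / (H (M + 1) * mu a b (M + 1)) := by positivity
  linarith

/-- The Poincaré inequality on `{0, …, M}`, from Hardy's inequality on fluxes. -/
theorem finite_poincare (h : IsChain N a b) (hc0 : 0 < c) {M : ℕ} (hM : (M : ℕ∞) ≤ N)
    (hP : ∀ φ : ℕ → ℝ, φ 0 = 0 → φ (M + 1) = 0 →
      c * ∑ i ∈ range M, φ (i + 1) ^ 2 / (mu a b i * b i)
        ≤ ∑ i ∈ range (M + 1), (φ (i + 1) - φ i) ^ 2 / mu a b i) (f : ℕ → ℝ) :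
    c * (∑ i ∈ range (M + 1), mu a b i * f i ^ 2
        - (∑ i ∈ range (M + 1), mu a b i * f i) ^ 2 / ∑ i ∈ range (M + 1), mu a b i)
      ≤ ∑ i ∈ range M, mu a b i * b i * (f (i + 1) - f i) ^ 2 := by
  set Z := ∑ i ∈ range (M + 1), mu a b i with hZ
  have hZpos : 0 < Z := sum_pos' (fun i _ => h.mu_nonneg i)
    ⟨0, by simp, h.mu_pos (by simp)⟩
  set s := ∑ i ∈ range (M + 1), mu a b i * f i with hs
  set G : ℕ → ℝ := fun i => f i - s / Z with hG
  set φ : ℕ → ℝ := fun i => ∑ j ∈ range i, mu a b j * G j with hφ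
  have hφs : ∀ i, φ (i + 1) - φ i = mu a b i * G i := fun i => by simp [hφ, sum_range_succ]
  have hφ0 : φ 0 = 0 := by simp [hφ]
  have hφM : φ (M + 1) = 0 := by
    simp only [hφ, hG, mul_sub, sum_sub_distrib, ← sum_mul]
    rw [← hs, ← hZ]
    field_simp
    ring
  have hV : ∑ i ∈ range (M + 1), mu a b i * G i ^ 2
      = ∑ i ∈ range (M + 1), mu a b i * f i ^ 2 - s ^ 2 / Z := by
    have : ∀ i, mu a b i * G i ^ 2
        = mu a b i * f i ^ 2 - mu a b i * f i * (2 * (s / Z)) + mu a b i * (s / Z) ^ 2 :=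
      fun i => by simp only [hG]; ring
    simp only [this, sum_add_distrib, sum_sub_distrib, ← sum_mul]
    rw [← hs, ← hZ]
    field_simp
    ring
  have h1 := hP φ hφ0 hφM
  have e1 : ∑ i ∈ range (M + 1), (φ (i + 1) - φ i) ^ 2 / mu a b i
      = ∑ i ∈ range (M + 1), mu a b i * G i ^ 2 := sum_congr rfl fun i hi => by
    have := (h.mu_pos (le_of_le_nat (Nat.lt_succ_iff.1 (mem_range.1 hi)) hM)).ne'
    rw [hφs]
    field_simp
  have e2 := sum_mul_sub_eq φ G hφ0 (M + 1)
  rw [sum_range_succ, hφM, zero_mul, zero_mul, add_zero, zero_sub] at e2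
  have e3 : ∑ i ∈ range (M + 1), (φ (i + 1) - φ i) * G i
      = ∑ i ∈ range (M + 1), mu a b i * G i ^ 2 := sum_congr rfl fun i _ => by
    rw [hφs]; ring
  rw [e3] at e2
  -- Young's inequality on each edge. The hypothesis `hP` bounds the first sum on the right by the
  -- variance divided by `c`, so one of the two copies of `c` times the variance is absorbed.
  have h2 : 2 * c * ∑ i ∈ range (M + 1), mu a b i * G i ^ 2
      ≤ c ^ 2 * ∑ i ∈ range M, φ (i + 1) ^ 2 / (mu a b i * b i)
        + ∑ i ∈ range M, mu a b i * b i * (f (i + 1) - f i) ^ 2 := by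
    rw [← neg_eq_iff_eq_neg.2 e2, ← sum_neg_distrib, mul_sum, mul_sum, ← sum_add_distrib]
    refine sum_le_sum fun i hi => ?_
    have := two_mul_le_sq_div_add (x := c * φ (i + 1)) (y := -(f (i + 1) - f i))
      (h.edge_pos (lt_of_lt_nat (mem_range.1 hi) hM))
    have e : G (i + 1) - G i = f (i + 1) - f i := by simp [hG]
    rw [e]
    rw [mul_pow, mul_div_assoc] at this
    linarith
  rw [e1] at h1
  have h3 := mul_le_mul_of_nonneg_left h1 hc0.le
  rw [← hV]
  linarith

/-- Barta's principle: a positive supersolution of the dual equation bounds `λ₁` from below. -/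
theorem le_spectralGap (h : IsChain N a b) {H : ℕ → ℝ} (hH0 : H 0 = 0)
    (hH : ∀ i : ℕ, 1 ≤ i → (i : ℕ∞) ≤ N → 0 < H i)
    (hHN : ∀ n : ℕ, (n : ℕ∞) = N → 0 ≤ H (n + 1))
    (hc : ∀ i : ℕ, (i : ℕ∞) < N → c * H (i + 1) ≤ dualGenerator a b H i) :
    c ≤ spectralGap N a b := by
  rcases le_or_gt c 0 with hc0 | hc0
  · exact hc0.trans h.spectralGap_nonneg
  refine le_csInf h.spectralGap_set_nonempty ?_
  rintro x ⟨f, hf, hf0, hf1, rfl⟩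
  rw [h.mem_maxDomain_iff] at hf
  have hs1 := h.summable_of_abs (h.summable_of_sq hf.1)
  rw [h.integral_eq] at hf0 hf1
  rw [h.dirichletForm_eq]
  have hfin : ∀ M : ℕ, (M : ℕ∞) ≤ N →
      c * (∑ i ∈ range (M + 1), mu a b i * f i ^ 2
        - (∑ i ∈ range (M + 1), mu a b i * f i) ^ 2 / ∑ i ∈ range (M + 1), mu a b i)
      ≤ ∑' i, mu a b i * b i * (f (i + 1) - f i) ^ 2 := fun M hM =>
    (h.finite_poincare hc0 hM (fun φ h0 h1 =>
      h.flux_le_of_supersolution hH0 h0 hH hHN hc hM h1) f).trans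
      (hf.2.sum_le_tsum _ fun i _ => mul_nonneg (h.edge_nonneg i) (sq_nonneg _))
  have hall : ∀ M : ℕ,
      c * (∑ i ∈ range (M + 1), mu a b i * f i ^ 2
        - (∑ i ∈ range (M + 1), mu a b i * f i) ^ 2 / ∑ i ∈ range (M + 1), mu a b i)
      ≤ ∑' i, mu a b i * b i * (f (i + 1) - f i) ^ 2 := fun M => by
    rcases le_or_gt (M : ℕ∞) N with hM | hM
    · exact hfin M hM
    lift N to ℕ using hM.ne_top
    have hM' : N + 1 ≤ M + 1 := by have : N < M := by exact_mod_cast hM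
                                   omega
    have hext : ∀ g : ℕ → ℝ, ∑ i ∈ range (M + 1), mu a b i * g i
        = ∑ i ∈ range (N + 1), mu a b i * g i := fun g =>
      (sum_subset (range_subset_range.2 hM') fun i _ hi => by
        rw [h.mu_eq_zero (by simpa using hi), zero_mul]).symm
    have h1 := hext fun _ => 1
    simp only [mul_one] at h1
    rw [hext f, hext fun i => f i ^ 2, h1]
    exact hfin N le_rfl
  -- In the limit the squared-mean correction disappears, because `f` has mean zero.
  have hlim := ((((tendsto_add_atTop_iff_nat 1).2 hf.1.hasSum.tendsto_sum_nat).sub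
    ((((tendsto_add_atTop_iff_nat 1).2 hs1.hasSum.tendsto_sum_nat).pow 2).div
      ((tendsto_add_atTop_iff_nat 1).2 h.summable_mu.hasSum.tendsto_sum_nat)
      h.mass_pos.ne')).const_mul c)
  have := le_of_tendsto' hlim hall
  rw [hf0, hf1] at this
  simpa using this

/-- Above `λ₁` and arbitrarily close to it, the shooting solution vanishes for the first time at
some edge or at the upper end. -/
theorem exists_first_zero (h : IsChain N a b) (hc : spectralGap N a b < c) :
    ∃ (l : ℝ) (k : ℕ), spectralGap N a b ≤ l ∧ l ≤ c ∧ 0 < l ∧ 1 ≤ k ∧ (k : ℕ∞) ≤ N ∧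
      (∀ i, 1 ≤ i → i ≤ k → 0 < flux a b l i) ∧ flux a b l (k + 1) = 0 := by
  classical
  -- Minimality of `k` is taken uniformly over the parameters in `[λ₁, c]`, so the earlier fluxes
  -- stay positive wherever the intermediate value theorem places the zero.
  have hex : ∃ k : ℕ, (k : ℕ∞) ≤ N ∧ ∃ l, spectralGap N a b ≤ l ∧ l ≤ c ∧
      flux a b l (k + 1) ≤ 0 := by
    by_contra! hcon
    have hpos : ∀ i : ℕ, (i : ℕ∞) ≤ N → 0 < flux a b c (i + 1) := fun i hi =>
      hcon i hi c hc.le le_rfl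
    refine hc.not_ge (h.le_spectralGap (H := flux a b c) flux_zero (fun i hi hiN => ?_)
      (fun n hn => (hpos n hn.le).le) fun i hi => (h.dualGenerator_flux hi).ge)
    obtain ⟨j, rfl⟩ := Nat.exists_eq_add_of_le' hi
    exact hpos j (le_of_le_nat (Nat.le_succ j) hiN)
  obtain ⟨hkN, l', hl1, hl2, hl3⟩ := Nat.find_spec hex
  have hmin : ∀ i, i < Nat.find hex → ∀ l, spectralGap N a b ≤ l → l ≤ c →
      0 < flux a b l (i + 1) := fun i hi l h1 h2 => by
    by_contra! h3
    exact Nat.find_min hex hi ⟨le_of_le_nat hi.le hkN, l, h1, h2, h3⟩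
  set k := Nat.find hex
  obtain ⟨l, hl, hl0⟩ := intermediate_value_Icc' hl1
    ((continuous_flux_slope a b (k + 1)).1.continuousOn) ⟨hl3, h.flux_nonneg hkN⟩
  refine ⟨l, k, hl.1, hl.2.trans hl2, ?_, ?_, hkN, fun i hi hik => ?_, hl0⟩
  -- At parameter `0` the slope is identically `1`, and the flux is a partial mass, which never
  -- vanishes.
  · refine (h.spectralGap_nonneg.trans hl.1).lt_of_ne ?_
    rintro rfl
    refine absurd hl0 (ne_of_gt ?_)
    simp only [flux_eq_sum, slope_of_zero, mul_one]
    exact sum_pos' (fun i _ => h.mu_nonneg i) ⟨0, by simp, h.mu_pos (by simp)⟩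
  · rcases Nat.eq_zero_or_pos k with h0 | h0
    · simp only [h0, zero_add, flux_one, one_ne_zero] at hl0
    · exact h0
  · obtain ⟨j, rfl⟩ := Nat.exists_eq_add_of_le' hi
    exact hmin j hik l hl.1 (hl.2.trans hl2)

end IsChain

end

/-! ### The difference form -/

section

/-- The value of `R_i(v)` as a real number, where it is finite. -/
noncomputable def realR (a b v : ℕ → ℝ) (i : ℕ) : ℝ :=
  a (i + 1) + b i - b (i + 1) * v i - if i = 0 then 0 else a i / v (i - 1)

/-- The flux whose increments have the ratios `v`. -/
noncomputable def ratioFlux (a b v : ℕ → ℝ) : ℕ → ℝ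
  | 0 => 0
  | i + 1 => ∏ j ∈ range i, b (j + 1) * v j / a (j + 1)

variable {a b v : ℕ → ℝ}

theorem R_eq_coe {i : ℕ} (hv : 1 ≤ i → v (i - 1) ≠ 0) : R a b v i = (realR a b v i : EReal) := by
  rw [R, realR, backRatio]
  rcases Nat.eq_zero_or_pos i with h | h
  · simp [h]
  · rw [if_neg (by omega), if_neg (hv h), if_neg (by omega), ← EReal.coe_sub]

theorem R_eq_bot {i : ℕ} (hi : 1 ≤ i) (hv : v (i - 1) = 0) : R a b v i = ⊥ := by
  rw [R, backRatio, if_neg (by omega), if_pos hv, EReal.sub_top]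

theorem ratioFlux_succ_succ (i : ℕ) :
    ratioFlux a b v (i + 2) = ratioFlux a b v (i + 1) * (b (i + 1) * v i / a (i + 1)) := by
  rw [ratioFlux, ratioFlux, prod_range_succ]

theorem dualGenerator_ratioFlux {i : ℕ} (ha : a (i + 1) ≠ 0)
    (hi : 1 ≤ i → v (i - 1) ≠ 0 ∧ a i ≠ 0) :
    dualGenerator a b (ratioFlux a b v) i = realR a b v i * ratioFlux a b v (i + 1) := by
  rw [dualGenerator, realR, ratioFlux_succ_succ]
  rcases i with _ | i
  · simp only [ratioFlux]
    field_simp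
    simp
  · obtain ⟨h1, h2⟩ := hi (by omega)
    rw [ratioFlux_succ_succ i, if_neg (by omega)]
    simp only [add_tsub_cancel_right] at h1 ⊢
    field_simp
    ring

namespace IsChain

variable {N : ℕ∞}

/-- Barta's principle for `ratioFlux`; past a finite upper end this flux vanishes because `b N = 0`.
-/
theorem iInf_R_le (h : IsChain N a b) (hv : v ∈ V N) :
    ⨅ (i : ℕ) (_ : (i : ℕ∞) < N), R a b v i ≤ ((spectralGap N a b : ℝ) : EReal) := by
  by_contra! hlt
  obtain ⟨c, hc1, hc2⟩ := EReal.lt_iff_exists_real_btwn.1 hlt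
  have hv' : ∀ i : ℕ, ((i + 1 : ℕ) : ℕ∞) < N → 0 < v i := fun i hi => hv i (by exact_mod_cast hi)
  refine (EReal.coe_lt_coe_iff.1 hc1).not_ge
    (h.le_spectralGap (H := ratioFlux a b v) rfl (fun i hi hiN => ?_) (fun n hn => ?_)
      fun i hi => ?_)
  · obtain ⟨j, rfl⟩ := Nat.exists_eq_add_of_le' hi
    refine prod_pos fun l hl => ?_
    have hl' := lt_of_lt_nat (Nat.succ_lt_succ (mem_range.1 hl)) hiN
    exact div_pos (mul_pos (h.birth_pos _ hl') (hv' l hl')) (h.death_pos _ (by omega) hl'.le)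
  · rcases n with _ | n
    · simp [ratioFlux]
    · rw [ratioFlux_succ_succ, h.birth_top _ hn]
      simp
  · have hvi : 1 ≤ i → v (i - 1) ≠ 0 := fun h1 =>
      (hv' (i - 1) (by rwa [Nat.sub_add_cancel h1])).ne'
    have h1 : (c : EReal) ≤ R a b v i := hc2.le.trans (iInf₂_le i hi)
    rw [R_eq_coe hvi, EReal.coe_le_coe_iff] at h1
    have hpos : 0 ≤ ratioFlux a b v (i + 1) := prod_nonneg fun l hl => by
      have hl' := lt_of_le_of_lt (b := (i : ℕ∞)) (by exact_mod_cast mem_range.1 hl :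
        ((l + 1 : ℕ) : ℕ∞) ≤ i) hi
      exact div_nonneg (mul_nonneg (h.birth_pos _ hl').le (hv' l hl').le)
        (h.death_pos _ (by omega) hl'.le).le
    rw [dualGenerator_ratioFlux (h.death_pos _ (by omega) (succ_le_of_lt hi)).ne'
      fun h1 => ⟨hvi h1, (h.death_pos i h1 hi.le).ne'⟩]
    exact mul_le_mul_of_nonneg_right h1 hpos

/-- The ratios of the increments of the shooting solution. -/
noncomputable def fluxRatio (a b : ℕ → ℝ) (c : ℝ) (i : ℕ) : ℝ :=
  flux a b c (i + 2) * a (i + 1) / (flux a b c (i + 1) * b (i + 1))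

theorem div_fluxRatio_eq (h : IsChain N a b) {c : ℝ} {i : ℕ} (hi : (i : ℕ∞) < N)
    (hp : 0 < flux a b c (i + 1)) (hprev : 1 ≤ i → v (i - 1) = fluxRatio a b c (i - 1))
    (hp' : 1 ≤ i → 0 < flux a b c i) :
    (if i = 0 then 0 else a i / v (i - 1)) = b i * flux a b c i / flux a b c (i + 1) := by
  rcases i with _ | i
  · simp [flux_zero]
  · have h3 := hp' (by omega)
    have h4 := h.death_pos (i + 1) (by omega) hi.le
    have h5 := h.birth_pos (i + 1) hi
    rw [if_neg (by omega), hprev (by omega)]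
    simp only [fluxRatio, add_tsub_cancel_right]
    field_simp

/-- Along the shooting solution `R` equals the parameter. -/
theorem rate_flux_eq (h : IsChain N a b) {c : ℝ} {i : ℕ} (hi : (i : ℕ∞) < N)
    (hp : 0 < flux a b c (i + 1)) (hv : b (i + 1) * v i = a (i + 1) * flux a b c (i + 2)
      / flux a b c (i + 1)) (hprev : 1 ≤ i → v (i - 1) = fluxRatio a b c (i - 1))
    (hp' : 1 ≤ i → 0 < flux a b c i) : realR a b v i = c := by
  have h1 := h.dualGenerator_flux (c := c) hi
  rw [dualGenerator] at h1
  have h2 := h.div_fluxRatio_eq hi hp hprev hp'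
  rw [realR, h2, hv]
  field_simp
  linarith

/-- The supremum is attained at the ratios of the shooting flux for `λ₁`. -/
theorem spectralGap_le_iSup_iInf_R (h : IsChain N a b) :
    ((spectralGap N a b : ℝ) : EReal)
      ≤ ⨆ v ∈ V N, ⨅ (i : ℕ) (_ : (i : ℕ∞) < N), R a b v i := by
  set c := spectralGap N a b
  have hpos : ∀ i : ℕ, (i : ℕ∞) < N → 0 < flux a b c (i + 1) := fun i hi =>
    h.flux_pos (succ_le_of_lt hi)
  have hvpos : ∀ i : ℕ, ((i + 1 : ℕ) : ℕ∞) < N → 0 < fluxRatio a b c i := fun i hi => by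
    have hi' : (i : ℕ∞) < N := lt_of_succ_le hi.le
    exact div_pos (mul_pos (hpos _ hi) (h.death_pos _ (by omega) hi.le))
      (mul_pos (hpos _ hi') (h.birth_pos _ hi))
  refine le_iSup₂_of_le (fluxRatio a b c) (fun i hi => hvpos i (by exact_mod_cast hi)) ?_
  refine le_iInf₂ fun i hi => ?_
  have hprev : 1 ≤ i → ((i - 1 + 1 : ℕ) : ℕ∞) < N := fun h1 => by rwa [Nat.sub_add_cancel h1]
  rw [R_eq_coe fun h1 => (hvpos _ (hprev h1)).ne', EReal.coe_le_coe_iff]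
  have hp := hpos i hi
  have hp' : 1 ≤ i → 0 < flux a b c i := fun h1 => by
    have := hpos (i - 1) (lt_of_succ_le (hprev h1).le)
    rwa [Nat.sub_add_cancel h1] at this
  rcases (succ_le_of_lt hi).lt_or_eq with h1 | h1
  · refine (h.rate_flux_eq hi hp ?_ (fun _ => rfl) hp').ge
    have := h.birth_pos _ h1
    rw [fluxRatio]
    field_simp
  · -- At the upper end the birth rate vanishes, and the flux beyond it is non-negative.
    have h2 := h.birth_top _ h1
    have h3 := h.flux_nonneg h1.le
    have h4 := h.dualGenerator_flux (c := c) hi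
    rw [dualGenerator] at h4
    have h6 := h.div_fluxRatio_eq hi hp (fun _ => rfl) hp'
    rw [realR, h2, h6, zero_mul, sub_zero, ← sub_nonneg]
    have h5 := mul_nonneg (h.death_pos _ (by omega) h1.le).le h3
    have h7 : a (i + 1) + b i - b i * flux a b c i / flux a b c (i + 1) - c
        = a (i + 1) * flux a b c (i + 2) / flux a b c (i + 1) := by
      field_simp
      linarith
    rw [h7]
    exact div_nonneg h5 hp.le

/-! ### Local test sequences -/

/-- Green's formula for the dual generator. -/
theorem sum_sq_flux_eq (h : IsChain N a b) {φ : ℕ → ℝ} (h0 : φ 0 = 0) {m : ℕ}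
    (hm : (m : ℕ∞) ≤ N) :
    ∑ i ∈ range m, (φ (i + 1) - φ i) ^ 2 / mu a b i
      = ∑ i ∈ range m, φ (i + 1) * dualGenerator a b φ i / (mu a b i * b i)
        + φ m * (φ (m + 1) - φ m) / mu a b m := by
  have h1 := sum_mul_sub_eq φ (fun i => (φ (i + 1) - φ i) / mu a b i) h0 m
  have h2 : ∑ i ∈ range m, φ (i + 1) * dualGenerator a b φ i / (mu a b i * b i)
      = -∑ i ∈ range m, φ (i + 1) * ((φ (i + 2) - φ (i + 1)) / mu a b (i + 1)
        - (φ (i + 1) - φ i) / mu a b i) := by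
    rw [← sum_neg_distrib]
    refine sum_congr rfl fun i hi => ?_
    have hi' := lt_of_lt_nat (mem_range.1 hi) hm
    have := (h.edge_pos hi').ne'
    rw [← h.edge_mul_sub φ hi', mul_div_assoc, mul_div_cancel_left₀ _ this]
    ring
  have h3 : ∑ i ∈ range m, (φ (i + 1) - φ i) ^ 2 / mu a b i
      = ∑ i ∈ range m, (φ (i + 1) - φ i) * ((φ (i + 1) - φ i) / mu a b i) :=
    sum_congr rfl fun i _ => by ring
  rw [h2, h1, h3]
  ring

theorem VTilde_pos (h : IsChain N a b) {m : ℕ} (hm : (m : ℕ∞) ≤ N) (hv : v ∈ VTilde a b m) {i : ℕ}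
    (hi : i + 2 ≤ m) : 0 < v i := by
  refine lt_of_le_of_lt ?_ (hv.1 i hi).1
  have h1 := h.death_pos (i + 1) (by omega) (le_of_le_nat (by omega) hm)
  have h2 := h.death_pos (i + 2) (by omega) (le_of_le_nat hi hm)
  have h3 := h.birth_pos (i + 1) (lt_of_lt_nat (by omega) hm)
  positivity

theorem realR_update {m i : ℕ} (hi : i < m) :
    realR (Function.update a m (aTilde N a b m)) b v i
      = realR a b v i + if i + 1 = m then aTilde N a b m - a m else 0 := by
  rw [realR, realR, Function.update_of_ne (by omega : i ≠ m)]
  by_cases h1 : i + 1 = m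
  · rw [h1, Function.update_self, if_pos rfl]; ring
  · rw [Function.update_of_ne h1, if_neg h1]; ring

theorem spectralGap_le_iSup_RTilde (h : IsChain N a b) {m : ℕ} (hm2 : 2 ≤ m) (hm : (m : ℕ∞) ≤ N)
    (hv : v ∈ VTilde a b m) :
    ((spectralGap N a b : ℝ) : EReal) ≤ ⨆ (i : ℕ) (_ : (i : ℕ∞) < N), RTilde N a b m v i := by
  by_contra! hlt
  obtain ⟨c, hc1, hc2⟩ := EReal.lt_iff_exists_real_btwn.1 hlt
  rw [EReal.coe_lt_coe_iff] at hc2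
  have hvi : ∀ i, i < m → 1 ≤ i → v (i - 1) ≠ 0 := fun i hi h1 =>
    (h.VTilde_pos hm hv (by omega)).ne'
  have hr : ∀ i, i < m →
      realR a b v i + (if i + 1 = m then aTilde N a b m - a m else 0) ≤ c := fun i hi => by
    have h1 : RTilde N a b m v i ≤ c :=
      (le_iSup₂ (f := fun (i : ℕ) (_ : (i : ℕ∞) < N) => RTilde N a b m v i) i
        (lt_of_lt_nat hi hm)).trans hc1.le
    rwa [RTilde, R_eq_coe (hvi i hi), EReal.coe_le_coe_iff, realR_update hi] at h1
  set φ := ratioFlux a b v with hφ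
  have hpos : ∀ i, i < m → 0 < φ (i + 1) := fun i hi => prod_pos fun j hj => by
    have := mem_range.1 hj
    exact div_pos (mul_pos (h.birth_pos _ (lt_of_lt_nat (by omega) hm))
      (h.VTilde_pos hm hv (by omega))) (h.death_pos _ (by omega) (le_of_le_nat (by omega) hm))
  have hgap := h.spectralGap_mul_flux_le (φ := φ) rfl hm
  rw [h.sum_sq_flux_eq (φ := φ) rfl hm] at hgap
  obtain ⟨n, rfl⟩ := Nat.exists_eq_add_of_le' (by omega : 1 ≤ m)
  have hend : φ (n + 1 + 1) = 0 := by
    rw [hφ, ratioFlux_succ_succ, hv.2 n le_rfl]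
    simp
  have hgen : ∀ i, i < n + 1 → dualGenerator a b φ i = realR a b v i * φ (i + 1) := fun i hi =>
    dualGenerator_ratioFlux (h.death_pos _ (by omega) (le_of_le_nat hi hm)).ne' fun h1 =>
      ⟨hvi i hi h1, (h.death_pos _ h1 (le_of_le_nat hi.le hm)).ne'⟩
  -- The flux vanishes after `m = n + 1`, so the boundary terms amount to `φ_m² (1 / T_m - 1 / μ_m)`
  -- with `T_m` the tail mass. This equals `(ã_m - a_m) φ_m² / (μ_m a_m)`, exactly the effect of
  -- replacing `a_m` by `ã_m`.
  have hsum : ∑ i ∈ range (n + 1), φ (i + 1) * dualGenerator a b φ i / (mu a b i * b i)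
      + φ (n + 1) * (φ (n + 1 + 1) - φ (n + 1)) / mu a b (n + 1)
      + φ (n + 1) ^ 2 / tailSum N (mu a b) (n + 1)
      = ∑ i ∈ range (n + 1), (realR a b v i
          + if i + 1 = n + 1 then aTilde N a b (n + 1) - a (n + 1) else 0)
        * (φ (i + 1) ^ 2 / (mu a b i * b i)) := by
    have hne : ∀ i ∈ range n, (realR a b v i
        + if i + 1 = n + 1 then aTilde N a b (n + 1) - a (n + 1) else 0)
        * (φ (i + 1) ^ 2 / (mu a b i * b i))
        = φ (i + 1) * dualGenerator a b φ i / (mu a b i * b i) := fun i hi => by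
      have := mem_range.1 hi
      rw [if_neg (by omega), hgen i (by omega)]
      ring
    rw [sum_range_succ, sum_range_succ, sum_congr rfl hne, if_pos rfl, hend, hgen n (by omega),
      ← h.mu_succ_mul (lt_of_succ_le hm), aTilde]
    have h1 := (h.mu_pos hm).ne'
    have h2 := (h.tailSum_mu_pos hm).ne'
    have h3 := (h.death_pos (n + 1) (by omega) hm).ne'
    field_simp
    ring
  rw [hsum] at hgap
  have hle : ∑ i ∈ range (n + 1), (realR a b v i
        + if i + 1 = n + 1 then aTilde N a b (n + 1) - a (n + 1) else 0)
        * (φ (i + 1) ^ 2 / (mu a b i * b i))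
      ≤ c * ∑ i ∈ range (n + 1), φ (i + 1) ^ 2 / (mu a b i * b i) := by
    rw [mul_sum]
    exact sum_le_sum fun i hi => mul_le_mul_of_nonneg_right (hr i (mem_range.1 hi))
      (div_nonneg (sq_nonneg _) (h.edge_nonneg i))
  have hS : 0 < ∑ i ∈ range (n + 1), φ (i + 1) ^ 2 / (mu a b i * b i) :=
    sum_pos (fun i hi => div_pos (pow_pos (hpos i (mem_range.1 hi)) 2)
      (h.edge_pos (lt_of_lt_nat (mem_range.1 hi) hm))) (by simp)
  exact hc2.not_ge (le_of_mul_le_mul_right (hgap.trans hle) hS)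

theorem iInf_RTilde_le (h : IsChain N a b) (h2 : 2 ≤ N) :
    (⨅ (m : ℕ) (_ : 2 ≤ m ∧ (m : ℕ∞) ≤ N), ⨅ v ∈ VTilde a b m,
      ⨆ (i : ℕ) (_ : (i : ℕ∞) < N), RTilde N a b m v i)
      ≤ ((spectralGap N a b : ℝ) : EReal) := by
  refine EReal.le_of_forall_lt_iff_le.1 fun c' hc' => ?_
  rw [EReal.coe_lt_coe_iff] at hc'
  have h0N : ((0 : ℕ) : ℕ∞) < N := lt_of_lt_of_le (by norm_num) h2
  have ha1 := h.death_pos 1 le_rfl (succ_le_of_lt h0N)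
  -- A first zero at `k = 1` would force the parameter to be `a 1 + b 0`; keeping `c` below that
  -- value guarantees `2 ≤ k`.
  have hfirst : spectralGap N a b < a 1 + b 0 := by
    have h1 := h.dualGenerator_flux (c := spectralGap N a b) h0N
    have h3 := mul_pos ha1 (h.flux_pos (k := 1) (by exact_mod_cast h2))
    simp only [dualGenerator, flux_zero, zero_add, flux_one] at h1 h3
    linarith
  obtain ⟨c, hc1, hc2⟩ := exists_between (lt_min hc' hfirst)
  obtain ⟨hcc, hc3⟩ := lt_min_iff.1 hc2
  obtain ⟨l, k, hl1, hlc, hl0, hk1, hkN, hpos, hzero⟩ := h.exists_first_zero hc1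
  have hk2 : 2 ≤ k := by
    by_contra! hk
    obtain rfl : k = 1 := by omega
    have h1 := h.dualGenerator_flux (c := l) h0N
    simp only [dualGenerator, flux_zero, zero_add, flux_one, hzero] at h1
    linarith
  set v : ℕ → ℝ := fun i => if i + 2 ≤ k then fluxRatio a b l i else 0 with hv
  have hF : ∀ i, i < k → 0 < flux a b l (i + 1) := fun i hi => hpos _ (by omega) hi
  have hvpos : ∀ i, i + 2 ≤ k → 0 < v i := fun i hi => by
    simp only [hv, if_pos hi]
    exact div_pos (mul_pos (hF _ hi) (h.death_pos _ (by omega) (le_of_le_nat (by omega) hkN)))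
      (mul_pos (hF _ (by omega)) (h.birth_pos _ (lt_of_lt_nat hi hkN)))
  have hrate : ∀ i, i < k → realR a b v i = l := fun i hi => by
    refine h.rate_flux_eq (lt_of_lt_nat hi hkN) (hF i hi) ?_ (fun h1 => ?_)
      fun h1 => hpos i h1 hi.le
    · rcases (Nat.succ_le_of_lt hi).lt_or_eq with h1 | h1
      · have := h.birth_pos (i + 1) (lt_of_lt_nat h1 hkN)
        have h3 := hF i hi
        simp only [hv, if_pos (show i + 2 ≤ k from h1), fluxRatio]
        field_simp
      · rw [show i + 2 = k + 1 by omega, hzero]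
        simp only [hv, if_neg (by omega : ¬ i + 2 ≤ k)]
        simp
    · simp only [hv, if_pos (by omega : i - 1 + 2 ≤ k)]
  refine iInf₂_le_of_le k ⟨hk2, hkN⟩ (iInf₂_le_of_le v ⟨fun i hi => ⟨?_, ?_⟩, fun i hi => ?_⟩ ?_)
  -- The lower constraint is the flux equation on edge `i + 1`: dropping `l H_{i+2} > 0` and
  -- `a_{i+2} H_{i+3} ≥ 0` leaves a strict inequality.
  · have hi1 := lt_of_lt_nat hi hkN
    have hg := h.dualGenerator_flux (c := l) hi1
    rw [dualGenerator] at hg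
    have h3 : 0 ≤ flux a b l (i + 3) := by
      rcases hi.lt_or_eq with h4 | h4
      · exact (hF _ h4).le
      · rw [show i + 3 = k + 1 by omega, hzero]
    have e1 := hF i (by omega)
    have e2 := hF (i + 1) (by omega)
    have e3 := h.death_pos (i + 1) (by omega) hi1.le
    have e4 := h.death_pos (i + 2) (by omega) (le_of_le_nat hi hkN)
    have e5 := h.birth_pos (i + 1) hi1
    simp only [hv, if_pos hi, fluxRatio]
    rw [div_lt_div_iff₀ (by positivity) (by positivity)]
    have e6 := mul_pos hl0 e2
    have e7 := mul_nonneg e4.le h3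
    have e8 : flux a b l (i + 1) * b (i + 1) < flux a b l (i + 2) * (a (i + 2) + b (i + 1)) := by
      linarith
    have := mul_lt_mul_of_pos_left e8 e3
    linarith
  -- The upper constraint says precisely that `realR a b v i`, which equals `l`, is positive.
  · have hi1 := lt_of_lt_nat hi hkN
    have e5 := h.birth_pos (i + 1) hi1
    have hr := hrate i (by omega)
    rw [realR] at hr
    rw [lt_div_iff₀ e5]
    linarith
  · exact if_neg (by omega)
  · refine iSup₂_le fun i hi => ?_
    rcases lt_or_ge i k with hik | hik
    · rw [RTilde, R_eq_coe fun h1 => (hvpos (i - 1) (by omega)).ne', EReal.coe_le_coe_iff,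
        realR_update hik, hrate i hik]
      have h3 : (if i + 1 = k then aTilde N a b k - a k else 0) ≤ 0 := by
        split_ifs
        · rw [sub_nonpos, aTilde, div_le_iff₀ (h.tailSum_mu_pos hkN), mul_comm]
          exact mul_le_mul_of_nonneg_left (h.mu_le_tailSum k) (h.death_pos k hk1 hkN).le
        · exact le_rfl
      linarith
    · rw [RTilde, R_eq_bot (by omega) (if_neg (by omega))]
      exact bot_le

end IsChain

end

/-! ### The single summation form -/

section

variable {N : ℕ∞} {a b f : ℕ → ℝ}

theorem strictMonoOn_E (hf : ∀ i : ℕ, (i : ℕ∞) < N → f i < f (i + 1)) : StrictMonoOn f (E N) := by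
  intro i _ j hj hij
  induction j, Nat.succ_le_of_lt hij using Nat.le_induction with
  | base => exact hf i (lt_of_succ_le hj)
  | succ j hij' ih =>
    exact (ih (le_of_le_nat (Nat.le_succ j) hj) hij').trans (hf j (lt_of_succ_le hj))

theorem monotoneOn_E (hf : ∀ i : ℕ, (i : ℕ∞) < N → f i ≤ f (i + 1)) : MonotoneOn f (E N) := by
  intro i _ j hj hij
  induction j, hij using Nat.le_induction with
  | base => exact le_rfl
  | succ j hij' ih =>
    exact (ih (le_of_le_nat (Nat.le_succ j) hj)).trans (hf j (lt_of_succ_le hj))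

theorem sum_range_le_of_eq_zero {g : ℕ → ℝ} {B : ℝ} (hg : ∀ i : ℕ, ¬ (i : ℕ∞) < N → g i = 0)
    (hB : ∀ n : ℕ, (n : ℕ∞) ≤ N → ∑ i ∈ range n, g i ≤ B) (n : ℕ) : ∑ i ∈ range n, g i ≤ B := by
  induction n with
  | zero => exact hB 0 (by simp)
  | succ n ih =>
    by_cases hn : (n : ℕ∞) < N
    · exact hB _ (succ_le_of_lt hn)
    · rwa [sum_range_succ, hg n hn, add_zero]

namespace IsChain

theorem inv_I_succ (h : IsChain N a b) (f : ℕ → ℝ) {j : ℕ} (hj : (j : ℕ∞) < N) :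
    (I N a b (centered N a b f) (j + 1))⁻¹ = mu a b j * b j * (f (j + 1) - f j)
      / tailSum N (fun i => mu a b i * centered N a b f i) (j + 1) := by
  rw [I, inv_div, centered_sub, h.mu_succ_mul hj, add_tsub_cancel_right]

/-- The tail sums of a centered non-constant monotone function are positive. -/
theorem tailSum_centered_pos (h : IsChain N a b) (hs : Summable fun i => mu a b i * f i)
    (hf : MonotoneOn f (E N)) (h01 : f 0 < f 1) {i : ℕ} (hi : 1 ≤ i) (hiN : (i : ℕ∞) ≤ N) :
    0 < tailSum N (fun j => mu a b j * centered N a b f j) i := by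
  set G := centered N a b f with hG
  have hsub : ∀ i j, G i - G j = f i - f j := fun i j => centered_sub f i j
  have hmono : ∀ i j : ℕ, i ≤ j → (j : ℕ∞) ≤ N → G i ≤ G j := fun i j hij hj => by
    linarith [hsub i j, hf (show i ∈ E N from le_of_le_nat hij hj) hj hij]
  have hsum : HasSum (fun i => mu a b i * G i) 0 := h.hasSum_centered hs
  have h1N : ((1 : ℕ) : ℕ∞) ≤ N := by exact_mod_cast h.one_le
  -- Otherwise `G` would be nonnegative and positive at `1`, against mean zero.
  have h0 : G 0 < 0 := by
    by_contra! hc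
    refine (hsum.summable.tsum_pos (fun i => ?_) 1 ?_).ne' hsum.tsum_eq
    · by_cases hi : (i : ℕ∞) ≤ N
      · exact mul_nonneg (h.mu_nonneg i) (hc.trans (hmono 0 i (Nat.zero_le i) hi))
      · rw [h.mu_eq_zero hi, zero_mul]
    · exact mul_pos (h.mu_pos h1N) (by linarith [hsub 0 1])
  -- According to the sign of `G i`, either all terms before `i` are nonpositive, or all terms from
  -- `i` on are positive.
  rcases le_or_gt (G i) 0 with hGi | hGi
  · rw [h.tailSum_centered hs, neg_pos]
    refine sum_neg' (fun j hj => ?_) ⟨0, mem_range.2 hi, ?_⟩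
    · exact mul_nonpos_of_nonneg_of_nonpos (h.mu_nonneg j)
        ((hmono j i (mem_range.1 hj).le hiN).trans hGi)
    · exact mul_neg_of_pos_of_neg (h.mu_pos (by simp)) h0
  · refine Summable.tsum_pos (hsum.summable.subtype _) (fun j => ?_) ⟨i, le_rfl, hiN⟩ ?_
    · exact mul_nonneg (h.mu_nonneg _) (hGi.le.trans (hmono i j j.2.1 j.2.2))
    · exact mul_pos (h.mu_pos hiN) hGi

theorem dualGenerator_tailSum (h : IsChain N a b) (hs : Summable fun i => mu a b i * f i) {i : ℕ}
    (hi : (i : ℕ∞) < N) :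
    dualGenerator a b (tailSum N fun j => mu a b j * centered N a b f j) i
      = mu a b i * b i * (f (i + 1) - f i) := by
  have h1 : ∀ j : ℕ, (j : ℕ∞) ≤ N →
      (tailSum N (fun j => mu a b j * centered N a b f j) (j + 1)
        - tailSum N (fun j => mu a b j * centered N a b f j) j) / mu a b j
      = -centered N a b f j := fun j hj => by
    have := (h.mu_pos hj).ne'
    rw [h.tailSum_centered hs, h.tailSum_centered hs, sum_range_succ]
    field_simp
    ring
  rw [← h.edge_mul_sub _ hi, h1 i hi.le, h1 (i + 1) (succ_le_of_lt hi), ← centered_sub]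
  ring

/-- Barta's principle for the tail sums of `f̄`. -/
theorem iInf_I_le (h : IsChain N a b) (hf : f ∈ FI N a b) :
    ⨅ (i : ℕ) (_ : 1 ≤ i ∧ i ∈ E N), (((I N a b (centered N a b f) i)⁻¹ : ℝ) : EReal)
      ≤ ((spectralGap N a b : ℝ) : EReal) := by
  obtain ⟨hf0, hfpos, hfm, hL⟩ := hf
  by_contra! hlt
  obtain ⟨c, hc1, hc2⟩ := EReal.lt_iff_exists_real_btwn.1 hlt
  have hs := h.summable_of_abs ((h.summable_vertex_iff _).1 hL)
  have h1N : 1 ∈ E N := by exact_mod_cast h.one_le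
  have hpos : ∀ i : ℕ, 1 ≤ i → (i : ℕ∞) ≤ N → _ := fun i hi hiN =>
    h.tailSum_centered_pos hs hfm.monotoneOn (by rw [hf0]; exact hfpos 1 h1N le_rfl) hi hiN
  have h0 : tailSum N (fun j => mu a b j * centered N a b f j) 0 = 0 := by
    rw [h.tailSum_centered hs]; simp
  refine (EReal.coe_lt_coe_iff.1 hc1).not_ge (h.le_spectralGap h0 hpos (fun n hn => ?_)
    fun i hi => ?_)
  · refine tsum_nonneg fun j => absurd j.2.2 ?_
    exact not_le.2 (hn.symm.trans_lt (by exact_mod_cast lt_of_lt_of_le (Nat.lt_succ_self n) j.2.1))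
  · have h1 : (c : EReal) ≤ (((I N a b (centered N a b f) (i + 1))⁻¹ : ℝ) : EReal) :=
      hc2.le.trans (iInf₂_le (i + 1) ⟨by omega, succ_le_of_lt hi⟩)
    rw [EReal.coe_le_coe_iff, h.inv_I_succ f hi,
      le_div_iff₀ (hpos (i + 1) (by omega) (succ_le_of_lt hi))] at h1
    rwa [h.dualGenerator_tailSum hs hi]

theorem tailSum_centered_of_slope (h : IsChain N a b) {c : ℝ}
    (hs : Summable fun i => mu a b i * f i) {i : ℕ} (hf : ∀ j < i, f j = 1 - slope a b c j) :
    tailSum N (fun j => mu a b j * centered N a b f j) i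
      = flux a b c i
        - (1 - (∑' j, mu a b j * f j) / ∑' j, mu a b j) * ∑ j ∈ range i, mu a b j := by
  rw [h.tailSum_centered hs, flux_eq_sum, mul_sum, ← sum_sub_distrib, ← sum_neg_distrib]
  refine sum_congr rfl fun j hj => ?_
  rw [h.centered_eq, hf j (mem_range.1 hj)]
  ring

theorem spectralGap_le_iSup_I_of_pos (h : IsChain N a b) (hpos : 0 < spectralGap N a b) :
    ((spectralGap N a b : ℝ) : EReal) ≤ ⨆ f ∈ FI N a b,
      ⨅ (i : ℕ) (_ : 1 ≤ i ∧ i ∈ E N), (((I N a b (centered N a b f) i)⁻¹ : ℝ) : EReal) := by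
  set c := spectralGap N a b with hc
  have hF : ∀ n, 0 ≤ flux a b c n := fun n => by
    induction n with
    | zero => exact le_rfl
    | succ n ih =>
      by_cases hn : (n : ℕ∞) ≤ N
      · exact h.flux_nonneg hn
      · rwa [flux_succ, h.mu_eq_zero hn, zero_mul, add_zero]
  have hslope : ∀ n, slope a b c n ≤ 1 := fun n => by
    induction n with
    | zero => exact le_rfl
    | succ n ih =>
      rw [slope_succ]
      linarith [div_nonneg (mul_nonneg hpos.le (hF (n + 1))) (h.edge_nonneg n)]
  -- Since `g ≤ 1`, `|g| ≤ 2 - g`, and the partial sums of `μ g` are fluxes, hence nonnegative.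
  have habs : Summable fun i => mu a b i * |slope a b c i| := by
    refine summable_of_sum_range_le (c := 2 * ∑' i, mu a b i)
      (fun i => mul_nonneg (h.mu_nonneg i) (abs_nonneg _)) fun n => ?_
    have h1 : ∑ i ∈ range n, mu a b i * |slope a b c i|
        ≤ ∑ i ∈ range n, (2 * mu a b i - mu a b i * slope a b c i) := by
      refine sum_le_sum fun i _ => ?_
      have : |slope a b c i| ≤ 2 - slope a b c i := abs_le.2 ⟨by linarith, by linarith [hslope i]⟩
      linarith [mul_le_mul_of_nonneg_left this (h.mu_nonneg i)]
    rw [sum_sub_distrib, ← mul_sum, ← flux_eq_sum] at h1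
    linarith [h.summable_mu.sum_le_tsum (range n) fun i _ => h.mu_nonneg i, hF n]
  set f : ℕ → ℝ := fun i => 1 - slope a b c i with hf
  have hinc : ∀ i : ℕ, (i : ℕ∞) < N → mu a b i * b i * (f (i + 1) - f i) = c * flux a b c (i + 1) :=
    fun i hi => by
      simp only [hf, sub_sub_sub_cancel_left]
      exact h.edge_mul_slope_sub hi
  have hmono : StrictMonoOn f (E N) := strictMonoOn_E fun i hi => by
    have h1 : 0 < mu a b i * b i * (f (i + 1) - f i) := by
      rw [hinc i hi]
      exact mul_pos hpos (h.flux_pos (succ_le_of_lt hi))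
    linarith [pos_of_mul_pos_right h1 (h.edge_pos hi).le]
  have hf0 : f 0 = 0 := by simp [hf, slope_zero]
  have hL : Summable fun i => mu a b i * |f i| := by
    refine Summable.of_nonneg_of_le (fun i => mul_nonneg (h.mu_nonneg i) (abs_nonneg _))
      (fun i => ?_) (h.summable_mu.add habs)
    have h1 : |f i| ≤ 1 + |slope a b c i| := by
      simpa using abs_sub (1 : ℝ) (slope a b c i)
    linarith [mul_le_mul_of_nonneg_left h1 (h.mu_nonneg i)]
  have hs := h.summable_of_abs hL
  have hZ0 : (0 : ℕ) ∈ E N := by simp [E]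
  have h1N : 1 ∈ E N := by exact_mod_cast h.one_le
  refine le_iSup₂_of_le f ⟨hf0, fun i hi h1 => ?_, hmono, (h.summable_vertex_iff _).2 hL⟩ ?_
  · rw [← hf0]
    exact hmono hZ0 hi h1
  refine le_iInf₂ fun i hi => ?_
  obtain ⟨hi1, hiN⟩ := hi
  obtain ⟨j, rfl⟩ := Nat.exists_eq_add_of_le' hi1
  have hj := lt_of_succ_le hiN
  have hT := h.tailSum_centered_pos hs hmono.monotoneOn (hmono hZ0 h1N one_pos) hi1 hiN
  rw [EReal.coe_le_coe_iff, h.inv_I_succ f hj, le_div_iff₀ hT, hinc j hj]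
  refine mul_le_mul_of_nonneg_left ?_ hpos.le
  -- The slope has nonnegative mean as a limit of fluxes, so `π(f) ≤ 1` and the tail sum is at most
  -- the flux.
  rw [h.tailSum_centered_of_slope (c := c) hs fun j _ => rfl, sub_le_self_iff]
  refine mul_nonneg ?_ (sum_nonneg fun i _ => h.mu_nonneg i)
  rw [sub_nonneg, div_le_one h.mass_pos]
  have h2 : 0 ≤ ∑' i, mu a b i * slope a b c i :=
    ge_of_tendsto' (h.summable_of_abs habs).hasSum.tendsto_sum_nat fun n => by
      rw [← flux_eq_sum]; exact hF n
  have h3 := h.summable_mu.tsum_sub (h.summable_of_abs habs)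
  have h4 : ∀ i, mu a b i * f i = mu a b i - mu a b i * slope a b c i := fun i => by
    simp only [hf]; ring
  rw [tsum_congr h4, h3]
  linarith

theorem spectralGap_le_iSup_I (h : IsChain N a b) :
    ((spectralGap N a b : ℝ) : EReal) ≤ ⨆ f ∈ FI N a b,
      ⨅ (i : ℕ) (_ : 1 ≤ i ∧ i ∈ E N), (((I N a b (centered N a b f) i)⁻¹ : ℝ) : EReal) := by
  rcases h.spectralGap_nonneg.lt_or_eq with h0 | h0
  · exact h.spectralGap_le_iSup_I_of_pos h0
  -- When `λ₁ = 0` the shooting solution is constant. Any bounded increasing function serves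
  -- instead, since only nonnegativity of the quotients is needed.
  set f : ℕ → ℝ := fun i => 1 - (1 / 2) ^ i with hf
  have hm : StrictMono f := strictMono_nat_of_lt_succ fun i => by
    have : (0 : ℝ) < (1 / 2) ^ i := by positivity
    simp only [hf, pow_succ]
    linarith
  have hf0 : f 0 = 0 := by simp [hf]
  have hL : Summable fun i => mu a b i * |f i| := by
    refine Summable.of_nonneg_of_le (fun i => mul_nonneg (h.mu_nonneg i) (abs_nonneg _))
      (fun i => mul_le_of_le_one_right (h.mu_nonneg i) ?_) h.summable_mu
    have h1 : (0 : ℝ) ≤ (1 / 2) ^ i := by positivity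
    have h2 : ((1 / 2 : ℝ)) ^ i ≤ 1 := pow_le_one₀ (by norm_num) (by norm_num)
    exact abs_le.2 ⟨by simp only [hf]; linarith, by simp only [hf]; linarith⟩
  have hs := h.summable_of_abs hL
  refine le_iSup₂_of_le f ⟨hf0, fun i _ h1 => ?_, hm.strictMonoOn _,
    (h.summable_vertex_iff _).2 hL⟩ (le_iInf₂ fun i hi => ?_)
  · rw [← hf0]
    exact hm h1
  · obtain ⟨hi1, hiN⟩ := hi
    obtain ⟨j, rfl⟩ := Nat.exists_eq_add_of_le' hi1
    rw [EReal.coe_le_coe_iff, h.inv_I_succ f (lt_of_succ_le hiN), ← h0]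
    exact div_nonneg (mul_nonneg (h.edge_nonneg j) (sub_nonneg.2 (hm (Nat.lt_succ_self j)).le))
      (h.tailSum_centered_pos hs (hm.monotone.monotoneOn _) (hm one_pos) hi1 hiN).le

/-! ### Upper bounds in summation form -/

theorem sum_tailSum_mul_le (h : IsChain N a b) (hL : Summable fun i => mu a b i * f i ^ 2)
    (hf : MonotoneOn f (E N)) (h01 : f 0 < f 1) {n : ℕ} (hn : (n : ℕ∞) ≤ N) :
    ∑ i ∈ range n, tailSum N (fun j => mu a b j * centered N a b f j) (i + 1) * (f (i + 1) - f i)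
      ≤ ∑' i, mu a b i * centered N a b f i ^ 2 := by
  have hs := h.summable_of_abs (h.summable_of_sq hL)
  have hsq := h.summable_centered_sq hL
  have hs1 := (h.hasSum_centered hs).summable
  set G := centered N a b f with hG
  set H := tailSum N fun j => mu a b j * G j with hH
  have hHeq : ∀ i, H i = -∑ j ∈ range i, mu a b j * G j := fun i => h.tailSum_centered hs i
  have h1 := sum_mul_sub_eq H G (by rw [hHeq]; simp) n
  have h2 : ∑ i ∈ range n, H (i + 1) * (f (i + 1) - f i)
      = ∑ i ∈ range n, H (i + 1) * (G (i + 1) - G i) :=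
    sum_congr rfl fun i _ => by rw [hG, centered_sub]
  have h3 : ∑ i ∈ range n, (H (i + 1) - H i) * G i = -∑ i ∈ range n, mu a b i * G i ^ 2 := by
    rw [← sum_neg_distrib]
    refine sum_congr rfl fun i _ => ?_
    rw [hHeq, hHeq, sum_range_succ]
    ring
  have h4 := h.tailSum_add (g := fun i => G i ^ 2) hsq n
  -- The boundary term is absorbed by the tail of the variance: if `G n ≥ 0` then `G j ≥ G n` beyond
  -- `n`, and otherwise it is nonpositive.
  have h5 : H n * G n ≤ tailSum N (fun j => mu a b j * G j ^ 2) n := by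
    rcases le_or_gt 0 (G n) with h0 | h0
    · rw [mul_comm, hH, tailSum, tailSum, ← tsum_mul_left]
      refine Summable.tsum_le_tsum (fun j => ?_) ((hs1.subtype _).mul_left _) (hsq.subtype _)
      have h6 : G n ≤ G j := by
        linarith [centered_sub (N := N) (a := a) (b := b) f j n,
          hf (show n ∈ E N from hn) (show (j : ℕ) ∈ E N from j.2.2) j.2.1]
      have := mul_le_mul_of_nonneg_right h6 (h0.trans h6)
      linarith [mul_le_mul_of_nonneg_left this (h.mu_nonneg j)]
    · refine (mul_nonpos_of_nonneg_of_nonpos ?_ h0.le).trans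
        (tsum_nonneg fun j => mul_nonneg (h.mu_nonneg _) (sq_nonneg _))
      rcases Nat.eq_zero_or_pos n with rfl | hn1
      · rw [hHeq]; simp
      · exact (h.tailSum_centered_pos hs hf h01 hn1 hn).le
  rw [h2, h1, h3]
  linarith

theorem spectralGap_le_iSup_inv_I (h : IsChain N a b) (hL : Summable fun i => mu a b i * f i ^ 2)
    (hf : MonotoneOn f (E N)) (h01 : f 0 < f 1) :
    ((spectralGap N a b : ℝ) : EReal)
      ≤ ⨆ (i : ℕ) (_ : 1 ≤ i ∧ i ∈ E N), (((I N a b (centered N a b f) i)⁻¹ : ℝ) : EReal) := by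
  by_contra! hlt
  obtain ⟨c, hc1, hc2⟩ := EReal.lt_iff_exists_real_btwn.1 hlt
  rw [EReal.coe_lt_coe_iff] at hc2
  have hs := h.summable_of_abs (h.summable_of_sq hL)
  have hsq := h.summable_centered_sq hL
  have hT : ∀ j : ℕ, (j : ℕ∞) < N → 0 < tailSum N (fun i => mu a b i * centered N a b f i) (j + 1) :=
    fun j hj => h.tailSum_centered_pos hs hf h01 (by omega) (succ_le_of_lt hj)
  have hle : ∀ j : ℕ, (j : ℕ∞) < N → mu a b j * b j * (f (j + 1) - f j)
      ≤ c * tailSum N (fun i => mu a b i * centered N a b f i) (j + 1) := fun j hj => by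
    have h1 : (((I N a b (centered N a b f) (j + 1))⁻¹ : ℝ) : EReal) ≤ c :=
      (le_iSup₂ (f := fun (i : ℕ) (_ : 1 ≤ i ∧ i ∈ E N) =>
        (((I N a b (centered N a b f) i)⁻¹ : ℝ) : EReal)) (j + 1)
        ⟨by omega, succ_le_of_lt hj⟩).trans hc1.le
    rwa [EReal.coe_le_coe_iff, h.inv_I_succ f hj, div_le_iff₀ (hT j hj)] at h1
  have h0N : ((0 : ℕ) : ℕ∞) < N := lt_of_lt_of_le (by norm_num) h.one_le
  have hc0 : 0 < c := by
    have h1 := (mul_pos (h.edge_pos h0N) (sub_pos.2 h01)).trans_le (hle 0 h0N)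
    exact pos_of_mul_pos_left h1 (hT 0 h0N).le
  set V := ∑' i, mu a b i * centered N a b f i ^ 2 with hV
  -- Finiteness of `D(f)` is not assumed. This bound provides it, and also `D(f) ≤ c V`, which
  -- contradicts the Poincaré inequality as `c < λ₁`.
  have hsum : ∀ n : ℕ, ∑ i ∈ range n, mu a b i * b i * (f (i + 1) - f i) ^ 2 ≤ c * V := by
    refine sum_range_le_of_eq_zero (N := N) (fun i hi => by rw [h.edge_eq_zero hi, zero_mul])
      fun n hn => ?_
    refine le_trans ?_ (mul_le_mul_of_nonneg_left (h.sum_tailSum_mul_le hL hf h01 hn) hc0.le)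
    rw [mul_sum]
    refine sum_le_sum fun i hi => ?_
    have hi' := lt_of_lt_nat (mem_range.1 hi) hn
    have h1 : 0 ≤ f (i + 1) - f i :=
      sub_nonneg.2 (hf (show i ∈ E N from hi'.le) (show i + 1 ∈ E N from succ_le_of_lt hi')
        (Nat.le_succ i))
    have := mul_le_mul_of_nonneg_right (hle i hi') h1
    linarith
  have hnn : ∀ i, 0 ≤ mu a b i * b i * (f (i + 1) - f i) ^ 2 := fun i =>
    mul_nonneg (h.edge_nonneg i) (sq_nonneg _)
  have hD := summable_of_sum_range_le hnn hsum
  have hgap := h.spectralGap_mul_le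
    (h.centered_mem_maxDomain ((h.mem_maxDomain_iff f).2 ⟨hL, hD⟩)) (h.hasSum_centered hs).tsum_eq
  rw [h.dirichletForm_eq, ← hV] at hgap
  simp only [centered_sub] at hgap
  have hVpos : 0 < V := by
    refine (tsum_nonneg fun i => mul_nonneg (h.mu_nonneg i) (sq_nonneg _)).lt_of_ne fun hV0 => ?_
    have hz := (hasSum_zero_iff_of_nonneg
      (fun i => mul_nonneg (h.mu_nonneg i) (sq_nonneg _))).1 (hV0 ▸ hsq.hasSum)
    have e0 : centered N a b f 0 = 0 := by
      simpa [(h.mu_pos (i := 0) (by simp)).ne'] using congrFun hz 0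
    have e1 : centered N a b f 1 = 0 := by
      simpa [(h.mu_pos (i := 1) (by exact_mod_cast h.one_le)).ne'] using congrFun hz 1
    have := centered_sub (N := N) (a := a) (b := b) f 1 0
    linarith
  exact hc2.not_ge (le_of_mul_le_mul_right (hgap.trans (Real.tsum_le_of_sum_range_le hnn hsum))
    hVpos)

theorem spectralGap_le_of_mem (h : IsChain N a b) (hf : f ∈ FITilde N ∪ FITilde' N a b) :
    ((spectralGap N a b : ℝ) : EReal)
      ≤ ⨆ (i : ℕ) (_ : 1 ≤ i ∧ i ∈ E N), (((I N a b (centered N a b f) i)⁻¹ : ℝ) : EReal) := by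
  have h1N : 1 ∈ E N := by exact_mod_cast h.one_le
  have hZ0 : (0 : ℕ) ∈ E N := by simp [E]
  rcases hf with ⟨hf0, m, hm, hm1, hfm, hmono⟩ | ⟨hL, hf0, hmono⟩
  · refine h.spectralGap_le_iSup_inv_I ?_ (monotoneOn_E fun i hi => ?_) ?_
    · have h1 := (h.hasSum_of_eventually_const (u := fun i => f (min i m) ^ 2) (m := m)
        fun i hi => by simp [hi]).summable
      refine h1.congr fun i => ?_
      by_cases hi : (i : ℕ∞) ≤ N
      · rcases Nat.eq_zero_or_pos i with rfl | h2
        · simp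
        · rw [← (hfm i hi h2).1]
      · rw [h.mu_eq_zero hi, zero_mul, zero_mul]
    · have hi1 := succ_le_of_lt hi
      rcases Nat.eq_zero_or_pos i with rfl | h2
      · rw [hf0]
        exact (hfm 1 h1N le_rfl).2.le
      · rw [(hfm i hi.le h2).1, (hfm (i + 1) hi1 (by omega)).1]
        exact hmono.monotoneOn ⟨by omega, by omega⟩ ⟨by omega, by omega⟩ (by omega)
    · rw [hf0]
      exact (hfm 1 h1N le_rfl).2
  · exact h.spectralGap_le_iSup_inv_I ((h.summable_vertex_iff _).1 hL) hmono.monotoneOn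
      (hmono hZ0 h1N one_pos)

theorem iInf_iSup_inv_I_le (h : IsChain N a b) :
    (⨅ f ∈ FITilde N ∪ FITilde' N a b, ⨆ (i : ℕ) (_ : 1 ≤ i ∧ i ∈ E N),
      (((I N a b (centered N a b f) i)⁻¹ : ℝ) : EReal))
      ≤ ((spectralGap N a b : ℝ) : EReal) := by
  refine EReal.le_of_forall_lt_iff_le.1 fun c hc => ?_
  rw [EReal.coe_lt_coe_iff] at hc
  obtain ⟨l, k, -, hlc, hl0, hk1, hkN, hpos, hzero⟩ := h.exists_first_zero hc
  -- The formal eigenfunction, frozen at the vertex after which its flux vanishes.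
  set f : ℕ → ℝ := fun i => 1 - slope a b l (min i k) with hf
  have hinc : ∀ i, i < k → mu a b i * b i * (f (i + 1) - f i) = l * flux a b l (i + 1) :=
    fun i hi => by
      simp only [hf, min_eq_left hi.le, min_eq_left (Nat.succ_le_of_lt hi), sub_sub_sub_cancel_left]
      exact h.edge_mul_slope_sub (lt_of_lt_nat hi hkN)
  have hmono : StrictMonoOn f (E (k : ℕ∞)) := strictMonoOn_E fun i hi => by
    have hi' : i < k := by exact_mod_cast hi
    have h1 : 0 < mu a b i * b i * (f (i + 1) - f i) := by
      rw [hinc i hi']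
      exact mul_pos hl0 (hpos _ (by omega) hi')
    linarith [pos_of_mul_pos_right h1 (h.edge_nonneg i)]
  have hE : ∀ i, i ≤ k → i ∈ E (k : ℕ∞) := fun i hi => by
    show (i : ℕ∞) ≤ k
    exact_mod_cast hi
  have hf0 : f 0 = 0 := by simp [hf, slope_zero]
  have hfk : ∀ i, f i = f (min i k) := fun i => by simp [hf]
  have hfc : ∀ i, k ≤ i → f i = f k := fun i hi => by simp [hf, hi]
  have hsum := h.hasSum_of_eventually_const hfc
  refine iInf₂_le_of_le f (Or.inl ⟨hf0, k, hkN, hk1, fun i _ hi1 => ⟨hfk i, ?_⟩,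
    hmono.mono fun i hi => hE i hi.2⟩) (iSup₂_le fun i hi => ?_)
  · rw [hfk, ← hf0]
    exact hmono (hE 0 (by omega)) (hE _ (min_le_right i k)) (by omega)
  obtain ⟨hi1, hiN⟩ := hi
  obtain ⟨j, rfl⟩ := Nat.exists_eq_add_of_le' hi1
  rw [EReal.coe_le_coe_iff, h.inv_I_succ f (lt_of_succ_le hiN)]
  refine le_trans ?_ hlc
  rcases lt_or_ge j k with hjk | hjk
  · have hFj := hpos (j + 1) (by omega) hjk
    -- This says `π(f) ≥ 1`. A zero flux after `k` means `μ_k g_k = -H_k < 0`; freezing weights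
    -- `g_k` with the tail mass, at least `μ_k`, so `1 - f` has nonpositive integral. Hence the tail
    -- sums of `f̄` dominate the flux.
    have hmass : ∑' i, mu a b i ≤ ∑' i, mu a b i * f i := by
      have h1 : ∑ i ∈ range k, mu a b i * f i = ∑ i ∈ range k, mu a b i - flux a b l k := by
        rw [flux_eq_sum, ← sum_sub_distrib]
        refine sum_congr rfl fun i hi => ?_
        simp only [hf, min_eq_left (mem_range.1 hi).le]
        ring
      have h2 := hpos k hk1 le_rfl
      rw [flux_succ] at hzero
      have h3 : slope a b l k ≤ 0 := by
        by_contra! h4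
        linarith [mul_pos (h.mu_pos hkN) h4]
      have h4 := mul_le_mul_of_nonpos_right (h.mu_le_tailSum k) h3
      rw [hsum.tsum_eq, h1, ← h.tailSum_mu_add k]
      simp only [hf, min_self]
      linarith
    have hT : flux a b l (j + 1)
        ≤ tailSum N (fun i => mu a b i * centered N a b f i) (j + 1) := by
      rw [h.tailSum_centered_of_slope (c := l) hsum.summable fun i hi => by
        simp only [hf, min_eq_left (by omega : i ≤ k)]]
      have h1 := (one_le_div h.mass_pos).2 hmass
      have h2 := mul_nonneg (sub_nonneg.2 h1)
        (sum_nonneg fun i (_ : i ∈ range (j + 1)) => h.mu_nonneg i)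
      linarith
    rw [hinc j hjk, div_le_iff₀ (hFj.trans_le hT)]
    exact mul_le_mul_of_nonneg_left hT hl0.le
  · rw [hfc j hjk, hfc (j + 1) (by omega), sub_self, mul_zero, zero_div]
    exact hl0.le

end IsChain

end

end BirthDeath

theorem theorem6p1 (N : ℕ∞) (hN : 1 ≤ N) (a b : ℕ → ℝ)
    (ha : ∀ i : ℕ, 1 ≤ i → (i : ℕ∞) ≤ N → 0 < a i)
    (hb : ∀ i : ℕ, (i : ℕ∞) < N → 0 < b i)
    (hbN : ∀ n : ℕ, (n : ℕ∞) = N → b n = 0)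
    (hmu : Summable fun i : BirthDeath.E N => BirthDeath.mu a b i) :
    -- difference form
    ((2 ≤ N →
        (⨅ (m : ℕ) (_ : 2 ≤ m ∧ (m : ℕ∞) ≤ N), ⨅ v ∈ BirthDeath.VTilde a b m,
          ⨆ (i : ℕ) (_ : (i : ℕ∞) < N), BirthDeath.RTilde N a b m v i)
        = ((BirthDeath.spectralGap N a b : ℝ) : EReal)) ∧
      ((BirthDeath.spectralGap N a b : ℝ) : EReal)
        = ⨆ v ∈ BirthDeath.V N, ⨅ (i : ℕ) (_ : (i : ℕ∞) < N), BirthDeath.R a b v i) ∧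
    -- single summation form
    ((⨅ f ∈ BirthDeath.FITilde N ∪ BirthDeath.FITilde' N a b,
          ⨆ (i : ℕ) (_ : 1 ≤ i ∧ i ∈ BirthDeath.E N),
            (((BirthDeath.I N a b (BirthDeath.centered N a b f) i)⁻¹ : ℝ) : EReal))
        = ((BirthDeath.spectralGap N a b : ℝ) : EReal) ∧
      ((BirthDeath.spectralGap N a b : ℝ) : EReal)
        = ⨆ f ∈ BirthDeath.FI N a b,
          ⨅ (i : ℕ) (_ : 1 ≤ i ∧ i ∈ BirthDeath.E N),
            (((BirthDeath.I N a b (BirthDeath.centered N a b f) i)⁻¹ : ℝ) : EReal)) := by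
  have h : BirthDeath.IsChain N a b := ⟨hN, ha, hb, hbN, hmu⟩
  refine ⟨⟨fun h2 => ?_, ?_⟩, ?_, ?_⟩
  · exact le_antisymm (h.iInf_RTilde_le h2)
      (le_iInf₂ fun m hm => le_iInf₂ fun v hv => h.spectralGap_le_iSup_RTilde hm.1 hm.2 hv)
  · exact le_antisymm h.spectralGap_le_iSup_iInf_R (iSup₂_le fun v hv => h.iInf_R_le hv)
  · exact le_antisymm h.iInf_iSup_inv_I_le (le_iInf₂ fun f hf => h.spectralGap_le_of_mem hf)
  · exact le_antisymm h.spectralGap_le_iSup_I (iSup₂_le fun f hf => h.iInf_I_le hf)
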